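/- Let $N\ge 3$, $2^*=\frac{2N}{N-2}$, let $\Omega\subset\mathbb R^N$ be a bounded domain with smooth boundary, let $a_1,\dots,a_k\in\Omega$ be pairwise distinct and $h_1,\dots,h_k\in C^1(\mathbb S^{N-1})$. Let $\mathcal D^{1,2}(\mathbb R^N)$ be the closure of $C_c^\infty(\mathbb R^N)$ in the norm $\|\nabla u\|_{L^2(\mathbb R^N)}$, and extend functions in $H^1_0(\Omega)$ by zero outside $\Omega$. Put $$\mathcal Q_\Omega(u)=\int_\Omega|\nabla u|^2\,dx-\sum_{i=1}^k\int_{\mathbb R^N}\frac{h_i\big(\frac{x-a_i}{|x-a_i|}\big)}{|x-a_i|^2}\,u^2\,dx,\qquad S_\Omega(h_1,\dots,h_k)=\inf_{u\in H^1_0(\Omega)\setminus\{0\}}\frac{\mathcal Q_\Omega(u)}{\|u\|_{L^{2^*}(\Omega)}^2},$$ $$S=\inf_{u\in\mathcal D^{1,2}(\mathbb R^N)\setminus\{0\}}\frac{\int_{\mathbb R^N}|\nabla u|^2dx}{\|u\|_{L^{2^*}(\mathbb R^N)}^2},\qquad S(h)=\inf_{u\in\mathcal D^{1,2}(\mathbb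 R^N)\setminus\{0\}}\frac{\int_{\mathbb R^N}\big[|\nabla u|^2-\frac{h(x/|x|)}{|x|^2}u^2\big]dx}{\|u\|_{L^{2^*}(\mathbb R^N)}^2},$$ $$S(h_1,\dots,h_k)=\inf_{u\in\mathcal D^{1,2}(\mathbb R^N)\setminus\{0\}}\frac{\int_{\mathbb R^N}|\nabla u|^2dx-\sum_{i=1}^k\int_{\mathbb R^N}\frac{h_i\big(\frac{x-a_i}{|x-a_i|}\big)}{|x-a_i|^2}u^2\,dx}{\|u\|_{L^{2^*}(\mathbb R^N)}^2}.$$ Assume that $\mathcal Q_\Omega$ is positive definite, i.e. $\mathcal Q_\Omega(u)\ge \kappa\int_\Omega|\nabla u|^2dx$ for some $\kappa>0$ and all $u\in H^1_0(\Omega)$. Let $\Lambda=S_\Omega(h_1,\dots,h_k)$ or, if the infimum $S(h_1,\dots,h_k)$ is finite, $\Lambda=S(h_1,\dots,h_k)$, and let $J_\Omega:H^1_0(\Omega)\to\mathbb R$, $$J_\Omega(v)=\tfrac12\mathcal Q_\Omega(v)-\frac{\Lambda}{2^*}\int_\Omega|v|^{2^*}dx .$$ Let $\{u_n\}\subset H^1_0(\Omega)$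 be a Palais–Smale sequence for $J_\Omega$ at a level $c\in\mathbb R$, i.e. $J_\Omega(u_n)\to c$ and $J_\Omega'(u_n)\to0$ in the dual space $(H^1_0(\Omega))^\star$, where $J_\Omega'$ is the Fréchet derivative. If $$c<\frac1N\,S_\Omega(h_1,\dots,h_k)^{1-\frac N2}\,\min\{S,S(h_1),\dots,S(h_k)\}^{N/2},$$ then $\{u_n\}$ has a subsequence converging strongly in $H^1_0(\Omega)$. -/

import Mathlib

open MeasureTheory Filter Topology Set
open scoped ContDiff Manifold ENNReal Gradient

noncomputable section

namespace MultiHardy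

/-- Euclidean space `ℝ^N`. -/
abbrev Euc (N : ℕ) : Type := EuclideanSpace ℝ (Fin N)

/-- The unit sphere `𝕊^{N-1}` of `ℝ^N`. -/
abbrev Sph (N : ℕ) : Type := Metric.sphere (0 : Euc N) 1

/-- Lets Mathlib regard `𝕊^{N-1}` as a smooth manifold of dimension `N - 1`. -/
instance factFinrank (N : ℕ) [hN : Fact (3 ≤ N)] :
    Fact (Module.finrank ℝ (Euc N) = N - 1 + 1) :=
  ⟨by have := hN.out; simp only [finrank_euclideanSpace, Fintype.card_fin]; omega⟩

/-- The critical Sobolev exponent `2^* = 2N / (N - 2)`. -/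
def twoStar (N : ℕ) : ℝ := 2 * N / (N - 2)

instance factTwoStar (N : ℕ) [hN : Fact (3 ≤ N)] :
    Fact ((1 : ℝ≥0∞) ≤ ENNReal.ofReal (twoStar N)) :=
  ⟨by
    have h3 : (3 : ℝ) ≤ N := by exact_mod_cast hN.out
    rw [ENNReal.one_le_ofReal, twoStar, le_div_iff₀ (by linarith)]
    linarith⟩

/-! ### Function spaces

An element of the spaces below is a pair `w = (u, ∇u)`: `w.fst` is the function `u` and `w.snd` is
its weak gradient. Functions on `Ω` are regarded as functions on `ℝ^N` vanishing outside `Ω`. -/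

/-- The pairs `(u, G)` with `u ∈ L^p(ℝ^N)` and `G ∈ L^2(ℝ^N; ℝ^N)`, with the norm
`(‖u‖_{L^p}² + ‖G‖_{L^2}²)^{1/2}`. -/
abbrev PairSpace (N : ℕ) (p : ℝ≥0∞) [Fact (1 ≤ p)] : Type :=
  WithLp 2 (Lp ℝ p (volume : Measure (Euc N)) × Lp (Euc N) 2 (volume : Measure (Euc N)))

/-- The space of the pairs `(φ, ∇φ)` with `φ ∈ C_c^∞(Ω)`. -/
def testPairs (N : ℕ) (p : ℝ≥0∞) [Fact (1 ≤ p)] (Ω : Set (Euc N)) :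
    Submodule ℝ (PairSpace N p) where
  carrier := {w | ∃ φ : Euc N → ℝ, ContDiff ℝ ∞ φ ∧ HasCompactSupport φ ∧ tsupport φ ⊆ Ω ∧
    w.fst =ᵐ[volume] φ ∧ w.snd =ᵐ[volume] fun x => ∇ φ x}
  zero_mem' := by
    refine ⟨0, contDiff_const, HasCompactSupport.zero, by simp, ?_, ?_⟩
    · exact Lp.coeFn_zero _ _ _
    · refine (Lp.coeFn_zero _ _ _).trans (Eventually.of_forall fun x => ?_)
      simp [gradient]
  add_mem' := by
    rintro w v ⟨φ, h1, h2, h3, h4, h5⟩ ⟨ψ, k1, k2, k3, k4, k5⟩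
    refine ⟨φ + ψ, h1.add k1, h2.add k2,
      (tsupport_add φ ψ).trans (union_subset h3 k3), ?_, ?_⟩
    · exact (Lp.coeFn_add _ _).trans (h4.add k4)
    · refine (Lp.coeFn_add _ _).trans ((h5.add k5).trans (Eventually.of_forall fun x => ?_))
      have e1 := (h1.differentiable (by simp)).differentiableAt (x := x)
      have e2 := (k1.differentiable (by simp)).differentiableAt (x := x)
      simp [gradient, fderiv_add e1 e2]
  smul_mem' := by
    rintro c w ⟨φ, h1, h2, h3, h4, h5⟩
    refine ⟨c • φ, h1.const_smul c, h2.smul_left (f := fun _ => c),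
      (tsupport_smul_subset_right (fun _ => c) φ).trans h3, ?_, ?_⟩
    · exact (Lp.coeFn_smul _ _).trans (h4.const_smul c)
    · refine (Lp.coeFn_smul _ _).trans ((h5.const_smul c).trans (Eventually.of_forall fun x => ?_))
      have e1 := (h1.differentiable (by simp)).differentiableAt (x := x)
      simp [gradient, fderiv_const_smul e1]

/-- `H^1_0(Ω)`: the closure of `C_c^∞(Ω)` in the norm `(‖u‖_{L^2}² + ‖∇u‖_{L^2}²)^{1/2}`. -/
abbrev H10 (N : ℕ) (Ω : Set (Euc N)) : Submodule ℝ (PairSpace N 2) :=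
  (testPairs N 2 Ω).topologicalClosure

/-- `D^{1,2}(ℝ^N)`: the closure of `C_c^∞(ℝ^N)` in the norm `‖∇u‖_{L^2}`. By Sobolev's inequality
this norm is equivalent on `C_c^∞(ℝ^N)` to `(‖u‖_{L^{2^*}}² + ‖∇u‖_{L^2}²)^{1/2}`, and the closure
is realized concretely as a space of functions in `L^{2^*}` with gradient in `L^2`. -/
abbrev D12 (N : ℕ) [Fact (3 ≤ N)] : Submodule ℝ (PairSpace N (ENNReal.ofReal (twoStar N))) :=
  (testPairs N (ENNReal.ofReal (twoStar N)) univ).topologicalClosure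

/-! ### Potentials, quadratic forms, best constants -/

/-- The potential `h(x/|x|) / |x|²` (with the irrelevant value `0` at `x = 0`). -/
def angularPotential {N : ℕ} (h : Sph N → ℝ) (x : Euc N) : ℝ :=
  if hx : x = 0 then 0
  else h ⟨‖x‖⁻¹ • x, by simp [norm_smul, norm_ne_zero_iff.mpr hx]⟩ / ‖x‖ ^ 2

/-- The best constant `S` in Sobolev's inequality, `inf ‖∇u‖_{L^2}² / ‖u‖_{L^{2^*}}²` over
`u ∈ D^{1,2}(ℝ^N) \ {0}`. -/
def sobolevS (N : ℕ) [Fact (3 ≤ N)] : ℝ :=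
  ⨅ w : {w : D12 N // w ≠ 0},
    (∫ x, ‖w.1.1.snd x‖ ^ 2) / (∫ x, |w.1.1.fst x| ^ twoStar N) ^ (2 / twoStar N)

/-- The constant `S(h)` of a single singularity. -/
def singleS {N : ℕ} [Fact (3 ≤ N)] (h : Sph N → ℝ) : ℝ :=
  ⨅ w : {w : D12 N // w ≠ 0},
    (∫ x, (‖w.1.1.snd x‖ ^ 2 - angularPotential h x * w.1.1.fst x ^ 2)) /
      (∫ x, |w.1.1.fst x| ^ twoStar N) ^ (2 / twoStar N)

/-- The Rayleigh quotient of `w ∈ D^{1,2}(ℝ^N)` whose infimum is `S(h_1, …, h_k)`. -/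
def wholeQuotient {N k : ℕ} [Fact (3 ≤ N)] (a : Fin k → Euc N) (h : Fin k → Sph N → ℝ)
    (w : D12 N) : ℝ :=
  ((∫ x, ‖w.1.snd x‖ ^ 2) - ∑ i, ∫ x, angularPotential (h i) (x - a i) * w.1.fst x ^ 2) /
    (∫ x, |w.1.fst x| ^ twoStar N) ^ (2 / twoStar N)

/-- The constant `S(h_1, …, h_k)` on the whole space. -/
def wholeS {N k : ℕ} [Fact (3 ≤ N)] (a : Fin k → Euc N) (h : Fin k → Sph N → ℝ) : ℝ :=
  ⨅ w : {w : D12 N // w ≠ 0}, wholeQuotient a h w.1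

/-- The quadratic form `Q_Ω` on `H^1_0(Ω)`. -/
def formQ {N k : ℕ} (Ω : Set (Euc N)) (a : Fin k → Euc N) (h : Fin k → Sph N → ℝ)
    (w : H10 N Ω) : ℝ :=
  (∫ x in Ω, ‖w.1.snd x‖ ^ 2) - ∑ i, ∫ x, angularPotential (h i) (x - a i) * w.1.fst x ^ 2

/-- `Q_Ω` is positive definite:
the infimum of `Q_Ω(u) / ‖∇u‖_{L^2}²` over `u ∈ H^1_0(Ω) \ {0}` is positive. -/
def FormPosDef {N k : ℕ} (Ω : Set (Euc N)) (a : Fin k → Euc N) (h : Fin k → Sph N → ℝ) : Prop :=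
  ∃ c : ℝ, 0 < c ∧ ∀ w : H10 N Ω, c * (∫ x in Ω, ‖w.1.snd x‖ ^ 2) ≤ formQ Ω a h w

/-- The constant `S_Ω(h_1, …, h_k)`. -/
def domainS {N k : ℕ} (Ω : Set (Euc N)) (a : Fin k → Euc N) (h : Fin k → Sph N → ℝ) : ℝ :=
  ⨅ w : {w : H10 N Ω // w ≠ 0},
    formQ Ω a h w.1 / (∫ x in Ω, |w.1.1.fst x| ^ twoStar N) ^ (2 / twoStar N)

/-- The functional `J_Ω(v) = Q_Ω(v)/2 - (Λ/2^*) ∫_Ω |v|^{2^*}` with coefficient `Λ`. -/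
def energyJ {N k : ℕ} (Ω : Set (Euc N)) (a : Fin k → Euc N) (h : Fin k → Sph N → ℝ) (Λ : ℝ)
    (w : H10 N Ω) : ℝ :=
  1 / 2 * formQ Ω a h w - Λ / twoStar N * ∫ x in Ω, |w.1.fst x| ^ twoStar N

/-- `min {S, S(h_1), …, S(h_k)}`. -/
def minS {N k : ℕ} [Fact (3 ≤ N)] (h : Fin k → Sph N → ℝ) : ℝ :=
  (insert (sobolevS N) (Finset.univ.image fun i => singleS (h i))).min' (Finset.insert_nonempty _ _)

/-! ### Domains -/

/-- `Ω` is a bounded domain with smooth boundary: near each boundary point, `Ω` is the negativity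
set of a smooth function without critical points. -/
structure IsBoundedSmoothDomain {N : ℕ} (Ω : Set (Euc N)) : Prop where
  isOpen : IsOpen Ω
  isConnected : IsConnected Ω
  isBounded : Bornology.IsBounded Ω
  smooth_boundary : ∀ x ∈ frontier Ω, ∃ U : Set (Euc N), IsOpen U ∧ x ∈ U ∧
    ∃ ρ : Euc N → ℝ, ContDiffOn ℝ ∞ ρ U ∧ (∀ y ∈ U, fderiv ℝ ρ y ≠ 0) ∧
      Ω ∩ U = {y ∈ U | ρ y < 0}

end MultiHardy

end

open MultiHardy

/-!
A Palais–Smale sequence is bounded, because `Q_Ω` is coercive and `J(u) - J'(u) u / 2^*` is a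
multiple of `Q_Ω(u)`. Pass to a weak limit `v` and put `z_n = u_n - v`. By Rellich's theorem
`z_n → 0` in `L²` and almost everywhere along a subsequence, and the Brezis–Lieb lemma, used for
`‖·‖^{2^*}` and for its derivative, shows that `Q_Ω(z_n)` and `Λ ‖z_n‖_{L^{2^*}}^{2^*}` have the
same limit `L ≤ N c`.

The poles are separated by a partition of unity of the form `sin² θ + cos² θ = 1`. The localization
error is of lower order, so each piece sees at most one pole, and its best constant is one of
`S, S(h_1), …, S(h_k)`. Hence `m ‖w‖_{L^{2^*}}² ≤ Q_Ω(w) + C ‖w‖_{L²}²` where `m` is the minimum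
of these constants. Along `z_n` this becomes `m (L / Λ)^{2 / 2^*} ≤ L`: either `L = 0` or
`L ≥ Λ^{1 - N / 2} m^{N / 2}`, and the second case is excluded by the bound on `c`. Thus
`Q_Ω(z_n) → 0` and coercivity gives `z_n → 0`.

That `S(h_i) ≥ 0`, so that `m ≥ 0`, follows from the positivity of `Q_Ω` by concentrating test
functions at `a_i`.
-/

open scoped NNReal

namespace MultiHardy

section TestFunctions

variable {N : ℕ} {Ω Ω' : Set (Euc N)} {φ : Euc N → ℝ}

/-- `φ ∈ C_c^∞(Ω)`. -/
structure IsTest (Ω : Set (Euc N)) (φ : Euc N → ℝ) : Prop where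
  smooth : ContDiff ℝ ∞ φ
  hasCompactSupport : HasCompactSupport φ
  tsupport_subset : tsupport φ ⊆ Ω

lemma enorm_gradient (φ : Euc N → ℝ) (x : Euc N) : ‖∇ φ x‖ₑ = ‖fderiv ℝ φ x‖ₑ := by
  simp only [enorm_eq_nnnorm, gradient, LinearIsometryEquiv.nnnorm_map]

lemma gradient_mul {f g : Euc N → ℝ} {x : Euc N} (hf : DifferentiableAt ℝ f x)
    (hg : DifferentiableAt ℝ g x) :
    ∇ (fun y => f y * g y) x = f x • ∇ g x + g x • ∇ f x := by
  simp only [gradient, fderiv_fun_mul hf hg, map_add, map_smul]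

lemma gradient_comp_smul_sub (hφ : Differentiable ℝ φ) (s : ℝ) (a x : Euc N) :
    ∇ (fun y => φ (s • (y - a))) x = s • ∇ φ (s • (x - a)) := by
  have hinner : HasFDerivAt (fun y : Euc N => s • (y - a)) (s • ContinuousLinearMap.id ℝ (Euc N))
      x := ((hasFDerivAt_id x).sub_const a).const_smul s
  have hcomp : fderiv ℝ (fun y => φ (s • (y - a))) x = s • fderiv ℝ φ (s • (x - a)) := by
    refine ((hφ _).hasFDerivAt.comp x hinner).fderiv.trans ?_
    ext z
    simp
  rw [gradient, hcomp, gradient, map_smul]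

namespace IsTest

lemma mono (hφ : IsTest Ω φ) (hΩ : Ω ⊆ Ω') : IsTest Ω' φ :=
  ⟨hφ.smooth, hφ.hasCompactSupport, hφ.tsupport_subset.trans hΩ⟩

lemma to_univ (hφ : IsTest Ω φ) : IsTest univ φ := hφ.mono (subset_univ _)

lemma mul_left (hφ : IsTest Ω φ) {η : Euc N → ℝ} (hη : ContDiff ℝ ∞ η) :
    IsTest Ω fun x => η x * φ x :=
  ⟨hη.mul hφ.smooth, hφ.hasCompactSupport.mul_left,
    (tsupport_mul_subset_right (f := η)).trans hφ.tsupport_subset⟩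

lemma differentiable (hφ : IsTest Ω φ) : Differentiable ℝ φ :=
  hφ.smooth.differentiable (by simp)

lemma continuous (hφ : IsTest Ω φ) : Continuous φ := hφ.smooth.continuous

lemma contDiff_one (hφ : IsTest Ω φ) : ContDiff ℝ 1 φ := hφ.smooth.of_le (by simp)

lemma continuous_gradient (hφ : IsTest Ω φ) : Continuous (∇ φ) :=
  (InnerProductSpace.toDual ℝ (Euc N)).symm.continuous.comp
    (hφ.smooth.continuous_fderiv (by simp))

lemma hasCompactSupport_gradient (hφ : IsTest Ω φ) : HasCompactSupport (∇ φ) :=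
  (hφ.hasCompactSupport.fderiv (𝕜 := ℝ)).comp_left
    (g := (InnerProductSpace.toDual ℝ (Euc N)).symm) (by simp)

lemma eq_zero (hφ : IsTest Ω φ) {x : Euc N} (hx : x ∉ Ω) : φ x = 0 :=
  image_eq_zero_of_notMem_tsupport fun h => hx (hφ.tsupport_subset h)

lemma gradient_eq_zero (hφ : IsTest Ω φ) {x : Euc N} (hx : x ∉ Ω) : ∇ φ x = 0 := by
  have : fderiv ℝ φ x = 0 := by
    by_contra hne
    exact hx (hφ.tsupport_subset (support_fderiv_subset ℝ hne))
  rw [gradient, this, map_zero]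

lemma memLp (hφ : IsTest Ω φ) (p : ℝ≥0∞) : MemLp φ p volume :=
  hφ.continuous.memLp_of_hasCompactSupport hφ.hasCompactSupport

lemma memLp_gradient (hφ : IsTest Ω φ) (p : ℝ≥0∞) : MemLp (∇ φ) p volume :=
  hφ.continuous_gradient.memLp_of_hasCompactSupport hφ.hasCompactSupport_gradient

lemma integrable_sq (hφ : IsTest Ω φ) : Integrable fun x => φ x ^ 2 :=
  (hφ.memLp 2).integrable_sq

lemma integrable_gradient_sq (hφ : IsTest Ω φ) : Integrable fun x => ‖∇ φ x‖ ^ 2 :=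
  (hφ.memLp_gradient 2).integrable_norm_pow (by simp)

lemma exists_comp_smul_sub (hφ : IsTest univ φ) : ∃ R, ∀ s : ℝ, 0 < s → ∀ a : Euc N,
    IsTest (Metric.closedBall a (R / s)) fun x => φ (s • (x - a)) := by
  obtain ⟨R, hR⟩ := hφ.hasCompactSupport.isCompact.isBounded.subset_closedBall 0
  refine ⟨R, fun s hs a => ?_⟩
  have hsupp : Function.support (fun x => φ (s • (x - a))) ⊆ Metric.closedBall a (R / s) := by
    intro x hx
    have hxR := mem_closedBall_zero_iff.1 (hR (subset_tsupport φ hx))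
    rw [norm_smul, Real.norm_of_nonneg hs.le] at hxR
    rwa [mem_closedBall_iff_norm, le_div_iff₀' hs]
  exact ⟨hφ.smooth.comp (by fun_prop), HasCompactSupport.of_support_subset_isCompact
    (isCompact_closedBall _ _) hsupp, closure_minimal hsupp Metric.isClosed_closedBall⟩

end IsTest

lemma exists_isTest_ne_zero (hΩ : IsOpen Ω) (hne : Ω.Nonempty) : ∃ φ, IsTest Ω φ ∧ φ ≠ 0 := by
  obtain ⟨x, hx⟩ := hne
  obtain ⟨φ, hsupp, hcompact, hsmooth, -, hφx⟩ := exists_contDiff_tsupport_subset (n := ⊤)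
    (hΩ.mem_nhds hx)
  exact ⟨φ, ⟨hsmooth, hcompact, hsupp⟩, fun h0 => by simp [h0] at hφx⟩

end TestFunctions

section Closure

variable {N : ℕ} {p q : ℝ≥0∞} [Fact (1 ≤ p)] {Ω : Set (Euc N)} {φ : Euc N → ℝ}

/-- The closure of the pairs `(φ, ∇φ)`, `φ ∈ C_c^∞(Ω)`, in `L^p × L²`: the common form of
`H^1_0(Ω)` (at `p = 2`) and `D^{1,2}(ℝ^N)` (at `p = 2^*`, `Ω = ℝ^N`). -/
noncomputable abbrev TestClosure (N : ℕ) (p : ℝ≥0∞) [Fact (1 ≤ p)] (Ω : Set (Euc N)) :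
    Submodule ℝ (PairSpace N p) :=
  (testPairs N p Ω).topologicalClosure

/-- `w` is the pair `(φ, ∇φ)` of a test function `φ ∈ C_c^∞(Ω)`; the two components of `w` are
only determined almost everywhere. -/
structure IsPair (Ω : Set (Euc N)) (w : PairSpace N p) (φ : Euc N → ℝ) : Prop where
  isTest : IsTest Ω φ
  fst_ae_eq : w.fst =ᵐ[volume] φ
  snd_ae_eq : w.snd =ᵐ[volume] ∇ φ

lemma mem_testPairs_iff {w : PairSpace N p} : w ∈ testPairs N p Ω ↔ ∃ φ, IsPair Ω w φ :=
  ⟨fun ⟨φ, h1, h2, h3, h4, h5⟩ => ⟨φ, ⟨h1, h2, h3⟩, h4, h5⟩,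
    fun ⟨φ, h1, h4, h5⟩ => ⟨φ, h1.smooth, h1.hasCompactSupport, h1.tsupport_subset, h4, h5⟩⟩

lemma IsPair.mem_testClosure {w : PairSpace N p} (hw : IsPair Ω w φ) : w ∈ TestClosure N p Ω :=
  (testPairs N p Ω).le_topologicalClosure (mem_testPairs_iff.2 ⟨φ, hw⟩)

lemma IsTest.exists_isPair (hφ : IsTest Ω φ) (p : ℝ≥0∞) [Fact (1 ≤ p)] :
    ∃ w : TestClosure N p Ω, IsPair Ω w.1 φ := by
  have hpair : IsPair Ω (WithLp.toLp 2 ((hφ.memLp p).toLp φ,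
      (hφ.memLp_gradient 2).toLp (∇ φ)) : PairSpace N p) φ :=
    ⟨hφ, (hφ.memLp p).coeFn_toLp, (hφ.memLp_gradient 2).coeFn_toLp⟩
  exact ⟨⟨_, hpair.mem_testClosure⟩, hpair⟩

lemma exists_isPair_tendsto (w : TestClosure N p Ω) :
    ∃ (φ : ℕ → Euc N → ℝ) (v : ℕ → TestClosure N p Ω), (∀ n, IsPair Ω (v n).1 (φ n)) ∧
      Tendsto v atTop (𝓝 w) := by
  obtain ⟨v, hv, hlim⟩ := mem_closure_iff_seq_limit.1 w.2
  choose φ hφ using fun n => mem_testPairs_iff.1 (hv n)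
  exact ⟨φ, fun n => ⟨v n, (hφ n).mem_testClosure⟩, hφ, tendsto_subtype_rng.2 hlim⟩

lemma testClosure_induction {P : TestClosure N p Ω → Prop} (hP : IsClosed {w | P w})
    (h : ∀ w φ, IsPair Ω w.1 φ → P w) (w : TestClosure N p Ω) : P w := by
  obtain ⟨φ, v, hv, hlim⟩ := exists_isPair_tendsto w
  exact hP.mem_of_tendsto hlim (Eventually.of_forall fun n => h _ _ (hv n))

variable (N p Ω) in
/-- The function `u` of a pair `(u, ∇u)`, as a bounded operator. -/
noncomputable def fstCLM : TestClosure N p Ω →L[ℝ] Lp ℝ p (volume : Measure (Euc N)) :=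
  (WithLp.fstL 2 ℝ _ _).comp (TestClosure N p Ω).subtypeL

variable (N p Ω) in
/-- The gradient `∇u` of a pair `(u, ∇u)`, as a bounded operator. -/
noncomputable def sndCLM : TestClosure N p Ω →L[ℝ] Lp (Euc N) 2 (volume : Measure (Euc N)) :=
  (WithLp.sndL 2 ℝ _ _).comp (TestClosure N p Ω).subtypeL

@[simp] lemma fstCLM_apply (w : TestClosure N p Ω) : fstCLM N p Ω w = w.1.fst := rfl

lemma ae_eq_zero_of_tendsto_Lp {α F : Type*} [MeasurableSpace α] {μ : Measure α}
    [NormedAddCommGroup F] [Fact (1 ≤ q)] {s : Set α} {f : ℕ → Lp F q μ} {g : Lp F q μ}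
    (h : Tendsto f atTop (𝓝 g)) (hf : ∀ n, ∀ᵐ x ∂μ, x ∈ s → f n x = 0) :
    ∀ᵐ x ∂μ, x ∈ s → g x = 0 := by
  obtain ⟨σ, -, hσ⟩ := (tendstoInMeasure_of_tendsto_Lp h).exists_seq_tendsto_ae
  filter_upwards [hσ, ae_all_iff.2 hf] with x hx hfx hxs
  exact tendsto_nhds_unique hx (by simp only [hfx _ hxs, tendsto_const_nhds])

lemma fst_eq_zero_of_notMem (w : TestClosure N p Ω) : ∀ᵐ x, x ∉ Ω → w.1.fst x = 0 := by
  obtain ⟨φ, v, hv, hlim⟩ := exists_isPair_tendsto w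
  refine ae_eq_zero_of_tendsto_Lp (s := Ωᶜ) (((fstCLM N p Ω).continuous.tendsto w).comp hlim)
    fun n => ?_
  filter_upwards [(hv n).fst_ae_eq] with x hx hxΩ
  exact hx.trans ((hv n).isTest.eq_zero hxΩ)

lemma snd_eq_zero_of_notMem (w : TestClosure N p Ω) : ∀ᵐ x, x ∉ Ω → w.1.snd x = 0 := by
  obtain ⟨φ, v, hv, hlim⟩ := exists_isPair_tendsto w
  refine ae_eq_zero_of_tendsto_Lp (s := Ωᶜ) (((sndCLM N p Ω).continuous.tendsto w).comp hlim)
    fun n => ?_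
  filter_upwards [(hv n).snd_ae_eq] with x hx hxΩ
  exact hx.trans ((hv n).isTest.gradient_eq_zero hxΩ)

lemma norm_sq_Lp_two {α F : Type*} [MeasurableSpace α] {μ : Measure α} [NormedAddCommGroup F]
    [InnerProductSpace ℝ F] (f : Lp F 2 μ) : ‖f‖ ^ 2 = ∫ x, ‖f x‖ ^ 2 ∂μ := by
  simp only [← real_inner_self_eq_norm_sq, L2.inner_def]

lemma setIntegral_norm_snd_sq (w : TestClosure N p Ω) :
    ∫ x in Ω, ‖w.1.snd x‖ ^ 2 = ‖w.1.snd‖ ^ 2 := by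
  rw [norm_sq_Lp_two]
  refine setIntegral_eq_integral_of_ae_compl_eq_zero ?_
  filter_upwards [snd_eq_zero_of_notMem w] with x hx hxΩ
  simp [hx hxΩ]

end Closure

section GradientWeights

variable {N : ℕ} {p q : ℝ≥0∞} [Fact (1 ≤ p)] {Ω : Set (Euc N)} {g : Euc N → ℝ}

/-- The weighted Sobolev-type inequality `‖g φ‖_{L^q} ≤ C ‖∇φ‖_{L²}` on `C_c^∞(Ω)`. The
inequalities of Sobolev, Poincaré and Hardy are instances. -/
structure IsGradientWeight (Ω : Set (Euc N)) (q : ℝ≥0∞) (g : Euc N → ℝ) : Prop where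
  measurable : Measurable g
  exists_le : ∃ C : ℝ≥0, ∀ φ, IsTest Ω φ →
    eLpNorm (fun x => g x * φ x) q volume ≤ C * eLpNorm (∇ φ) 2 volume

namespace IsGradientWeight

lemma exists_eLpNorm_mul_fst_le (hg : IsGradientWeight Ω q g) : ∃ C : ℝ≥0,
    ∀ w : TestClosure N p Ω,
      eLpNorm (fun x => g x * w.1.fst x) q volume ≤ C * eLpNorm w.1.snd 2 volume := by
  obtain ⟨C, hC⟩ := hg.exists_le
  refine ⟨C, fun w => ?_⟩
  obtain ⟨φ, v, hv, hlim⟩ := exists_isPair_tendsto w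
  have hfst : Tendsto (fun n => (v n).1.fst) atTop (𝓝 w.1.fst) :=
    ((fstCLM N p Ω).continuous.tendsto w).comp hlim
  have hsnd : Tendsto (fun n => (v n).1.snd) atTop (𝓝 w.1.snd) :=
    ((sndCLM N p Ω).continuous.tendsto w).comp hlim
  obtain ⟨σ, hσ, hae⟩ := (tendstoInMeasure_of_tendsto_Lp hfst).exists_seq_tendsto_ae
  have hbound : Tendsto (fun n => C * eLpNorm (v (σ n)).1.snd 2 volume) atTop
      (𝓝 (C * eLpNorm w.1.snd 2 volume)) := by
    refine ENNReal.Tendsto.const_mul ?_ (Or.inr ENNReal.coe_ne_top)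
    simpa only [Lp.enorm_def, Function.comp_def] using
      ((continuous_enorm.tendsto _).comp hsnd).comp hσ.tendsto_atTop
  have hv_le : ∀ n, eLpNorm (fun x => g x * (v (σ n)).1.fst x) q volume ≤
      C * eLpNorm (v (σ n)).1.snd 2 volume := fun n => by
    rw [eLpNorm_congr_ae (hv (σ n)).snd_ae_eq]
    refine le_of_eq_of_le (eLpNorm_congr_ae ?_) (hC _ (hv (σ n)).isTest)
    filter_upwards [(hv (σ n)).fst_ae_eq] with x hx
    rw [hx]
  calc eLpNorm (fun x => g x * w.1.fst x) q volume
      ≤ liminf (fun n => eLpNorm (fun x => g x * (v (σ n)).1.fst x) q volume) atTop :=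
        Lp.eLpNorm_lim_le_liminf_eLpNorm
          (fun n => hg.measurable.aestronglyMeasurable.mul (Lp.aestronglyMeasurable _)) _
          (hae.mono fun x hx => hx.const_mul _)
    _ ≤ liminf (fun n => C * eLpNorm (v (σ n)).1.snd 2 volume) atTop :=
        liminf_le_liminf (Eventually.of_forall hv_le)
    _ = C * eLpNorm w.1.snd 2 volume := hbound.liminf_eq

lemma memLp_mul_fst (hg : IsGradientWeight Ω q g) (w : TestClosure N p Ω) :
    MemLp (fun x => g x * w.1.fst x) q volume := by
  obtain ⟨C, hC⟩ := hg.exists_eLpNorm_mul_fst_le (p := p)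
  exact ⟨hg.measurable.aestronglyMeasurable.mul (Lp.aestronglyMeasurable _),
    (hC w).trans_lt (ENNReal.mul_lt_top ENNReal.coe_lt_top (Lp.eLpNorm_lt_top _))⟩

/-- The linear map `u ↦ g u`; its boundedness into `L^q` is `exists_norm_mulLinear_le`. -/
noncomputable def mulLinear (hg : IsGradientWeight Ω q g) :
    TestClosure N p Ω →ₗ[ℝ] Lp ℝ q (volume : Measure (Euc N)) where
  toFun w := (hg.memLp_mul_fst w).toLp
  map_add' w v := by
    rw [← MemLp.toLp_add, MemLp.toLp_eq_toLp_iff]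
    filter_upwards [Lp.coeFn_add w.1.fst v.1.fst] with x hx
    simp only [Pi.add_apply, Submodule.coe_add, WithLp.add_fst] at hx ⊢
    rw [hx, mul_add]
  map_smul' c w := by
    rw [RingHom.id_apply, ← MemLp.toLp_const_smul, MemLp.toLp_eq_toLp_iff]
    filter_upwards [Lp.coeFn_smul c w.1.fst] with x hx
    simp only [Pi.smul_apply, Submodule.coe_smul, WithLp.smul_fst, smul_eq_mul] at hx ⊢
    rw [hx, mul_left_comm]

lemma exists_norm_mulLinear_le (hg : IsGradientWeight Ω q g) : ∃ C : ℝ≥0,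
    ∀ w : TestClosure N p Ω, ‖hg.mulLinear w‖ ≤ C * ‖w.1.snd‖ := by
  obtain ⟨C, hC⟩ := hg.exists_eLpNorm_mul_fst_le (p := p)
  refine ⟨C, fun w => ?_⟩
  rw [mulLinear, LinearMap.coe_mk, AddHom.coe_mk, Lp.norm_toLp, Lp.norm_def]
  refine (ENNReal.toReal_mono (ENNReal.mul_ne_top ENNReal.coe_ne_top
    (Lp.eLpNorm_ne_top _)) (hC w)).trans_eq ?_
  rw [ENNReal.toReal_mul, ENNReal.coe_toReal]

variable [Fact (1 ≤ q)]

variable (p) in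
/-- Multiplication by the gradient weight `g`, as a bounded operator into `L^q`. -/
noncomputable def mulCLM (hg : IsGradientWeight Ω q g) :
    TestClosure N p Ω →L[ℝ] Lp ℝ q (volume : Measure (Euc N)) :=
  (hg.mulLinear (p := p)).mkContinuousOfExistsBound <| by
    obtain ⟨C, hC⟩ := hg.exists_norm_mulLinear_le (p := p)
    exact ⟨C, fun w => (hC w).trans (by gcongr; exact WithLp.norm_snd_le _ _)⟩

lemma coeFn_mulCLM (hg : IsGradientWeight Ω q g) (w : TestClosure N p Ω) :
    hg.mulCLM p w =ᵐ[volume] fun x => g x * w.1.fst x :=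
  (hg.memLp_mul_fst w).coeFn_toLp

lemma exists_norm_mulCLM_le (hg : IsGradientWeight Ω q g) : ∃ C : ℝ≥0,
    ∀ w : TestClosure N p Ω, ‖hg.mulCLM p w‖ ≤ C * ‖w.1.snd‖ :=
  hg.exists_norm_mulLinear_le

end IsGradientWeight

end GradientWeights

section SquareIntegrals

variable {α : Type*} [MeasurableSpace α] {μ : Measure α}

lemma sq_eLpNorm_two {F : Type*} [NormedAddCommGroup F] (f : α → F) :
    eLpNorm f 2 μ ^ 2 = ∫⁻ x, ‖f x‖ₑ ^ 2 ∂μ := by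
  simpa using eLpNorm_nnreal_pow_eq_lintegral (μ := μ) (f := f) (p := 2) two_ne_zero

lemma sq_lintegral_mul_le {f g : α → ℝ≥0∞} (hf : AEMeasurable f μ) (hg : AEMeasurable g μ) :
    (∫⁻ x, f x * g x ∂μ) ^ 2 ≤ (∫⁻ x, f x ^ 2 ∂μ) * ∫⁻ x, g x ^ 2 ∂μ := by
  have h := pow_le_pow_left' (ENNReal.lintegral_mul_le_Lp_mul_Lq μ .two_two hf hg) 2
  simp only [Pi.mul_apply, ENNReal.rpow_two, mul_pow] at h
  refine h.trans_eq ?_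
  simp only [← ENNReal.rpow_natCast, ← ENNReal.rpow_mul]
  norm_num

lemma sq_lintegral_le_measure_mul {f : α → ℝ≥0∞} (hf : AEMeasurable f μ) :
    (∫⁻ x, f x ∂μ) ^ 2 ≤ μ univ * ∫⁻ x, f x ^ 2 ∂μ := by
  simpa using sq_lintegral_mul_le (aemeasurable_const (b := 1)) hf

lemma sq_lintegral_Ioi_one_le {g : ℝ → ℝ≥0∞} (hg : Measurable g) (s : ℝ) :
    (∫⁻ t in Ioi (1 : ℝ), g t) ^ 2 ≤ (∫⁻ t in Ioi (1 : ℝ), ENNReal.ofReal (t ^ (-s))) *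
      ∫⁻ t in Ioi (1 : ℝ), ENNReal.ofReal (t ^ s) * g t ^ 2 := by
  have hsq (r : ℝ) {t : ℝ} (ht : t ∈ Ioi (1 : ℝ)) :
      ENNReal.ofReal (t ^ (r / 2)) ^ 2 = ENNReal.ofReal (t ^ r) := by
    have ht0 : 0 < t := one_pos.trans ht
    rw [← ENNReal.ofReal_pow (by positivity), ← Real.rpow_mul_natCast ht0.le]
    norm_num
  have hsplit : ∫⁻ t in Ioi (1 : ℝ), g t = ∫⁻ t in Ioi (1 : ℝ),
      ENNReal.ofReal (t ^ (-s / 2)) * (ENNReal.ofReal (t ^ (s / 2)) * g t) := by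
    refine setLIntegral_congr_fun measurableSet_Ioi fun t ht => ?_
    have ht0 : 0 < t := one_pos.trans ht
    rw [← mul_assoc, ← ENNReal.ofReal_mul (by positivity), ← Real.rpow_add ht0, neg_div,
      neg_add_cancel, Real.rpow_zero, ENNReal.ofReal_one, one_mul]
  rw [hsplit]
  refine (sq_lintegral_mul_le (by fun_prop) (by fun_prop)).trans_eq ?_
  congr 1
  · exact setLIntegral_congr_fun measurableSet_Ioi fun t ht => hsq _ ht
  · exact setLIntegral_congr_fun measurableSet_Ioi fun t ht => by simp only [mul_pow, hsq _ ht]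

lemma lintegral_Ioi_one_rpow_neg {s : ℝ} (hs : 1 < s) :
    ∫⁻ t in Ioi (1 : ℝ), ENNReal.ofReal (t ^ (-s)) = ENNReal.ofReal (s - 1)⁻¹ := by
  rw [← ofReal_integral_eq_lintegral_ofReal
    (integrableOn_Ioi_rpow_of_lt (by linarith) one_pos)
    ((ae_restrict_mem measurableSet_Ioi).mono fun t ht =>
      Real.rpow_nonneg (zero_le_one.trans (le_of_lt ht)) _),
    integral_Ioi_rpow_of_lt (by linarith) one_pos, Real.one_rpow, ← one_div]
  congr 1
  rw [← neg_div_neg_eq, neg_neg]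
  ring_nf

end SquareIntegrals

section FundamentalTheorem

variable {E F : Type*} [NormedAddCommGroup E] [NormedSpace ℝ E] [NormedAddCommGroup F]
  [NormedSpace ℝ F] {φ : E → F}

lemma enorm_sub_le_lintegral_fderiv_segment (hφ : ContDiff ℝ 1 φ) (x v : E) {a b : ℝ}
    (hab : a ≤ b) : ‖φ (x + b • v) - φ (x + a • v)‖ₑ ≤
      ‖v‖ₑ * ∫⁻ t in Icc a b, ‖fderiv ℝ φ (x + t • v)‖ₑ := by
  have hderiv (t : ℝ) : HasDerivAt (fun t : ℝ => φ (x + t • v)) (fderiv ℝ φ (x + t • v) v) t := by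
    have hline : HasDerivAt (fun t : ℝ => x + t • v) v t := by
      simpa using ((hasDerivAt_id t).smul_const v).const_add x
    exact (hφ.differentiable one_ne_zero _).hasFDerivAt.comp_hasDerivAt t hline
  have hsmooth : ContDiff ℝ 1 fun t : ℝ => φ (x + t • v) := hφ.comp (by fun_prop)
  refine (enorm_sub_le_lintegral_deriv_of_contDiffOn_Icc hsmooth.contDiffOn hab).trans ?_
  rw [← lintegral_const_mul' _ _ enorm_ne_top]
  refine lintegral_mono fun t => ?_
  rw [(hderiv t).deriv, mul_comm]
  exact (fderiv ℝ φ _).le_opENorm v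

lemma enorm_le_lintegral_fderiv_ray (hφ : ContDiff ℝ 1 φ) (hc : HasCompactSupport φ) {x : E}
    (hx : x ≠ 0) : ‖φ x‖ₑ ≤ ‖x‖ₑ * ∫⁻ t in Ioi (1 : ℝ), ‖fderiv ℝ φ (t • x)‖ₑ := by
  have hx0 : 0 < ‖x‖ := norm_pos_iff.2 hx
  obtain ⟨R, hR⟩ := hc.isCompact.isBounded.subset_ball 0
  set T : ℝ := max 1 (R / ‖x‖)
  have hT : 1 ≤ T := le_max_left _ _
  have hφT : φ (T • x) = 0 := by
    refine image_eq_zero_of_notMem_tsupport fun hmem => (mem_ball_zero_iff.1 (hR hmem)).not_ge ?_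
    rw [norm_smul, Real.norm_of_nonneg (zero_le_one.trans hT), ← div_le_iff₀ hx0]
    exact le_max_right _ _
  have hseg := enorm_sub_le_lintegral_fderiv_segment hφ 0 x hT
  simp only [zero_add, one_smul, hφT, zero_sub, enorm_neg] at hseg
  rw [setLIntegral_congr Ioc_ae_eq_Icc.symm] at hseg
  exact hseg.trans (by gcongr; exact Ioc_subset_Ioi_self)

lemma sq_enorm_inv_norm_smul_le (hφ : ContDiff ℝ 1 φ) (hc : HasCompactSupport φ) (x : E) (s : ℝ) :
    ‖‖x‖⁻¹ • φ x‖ₑ ^ 2 ≤ (∫⁻ t in Ioi (1 : ℝ), ENNReal.ofReal (t ^ (-s))) *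
      ∫⁻ t in Ioi (1 : ℝ), ENNReal.ofReal (t ^ s) * ‖fderiv ℝ φ (t • x)‖ₑ ^ 2 := by
  rcases eq_or_ne x 0 with rfl | hx
  · simp
  have hmeas : Measurable fun t : ℝ => ‖fderiv ℝ φ (t • x)‖ₑ :=
    ((hφ.continuous_fderiv one_ne_zero).comp (by fun_prop)).enorm.measurable
  refine le_trans ?_ (sq_lintegral_Ioi_one_le hmeas s)
  gcongr
  rw [enorm_smul, enorm_inv (norm_ne_zero_iff.2 hx), enorm_norm, mul_comm, ← div_eq_mul_inv]
  exact ENNReal.div_le_of_le_mul' (enorm_le_lintegral_fderiv_ray hφ hc hx)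

end FundamentalTheorem

section Hardy

variable {E F : Type*} [NormedAddCommGroup E] [NormedSpace ℝ E] [FiniteDimensional ℝ E]
  [MeasurableSpace E] [BorelSpace E] [NormedAddCommGroup F] [NormedSpace ℝ F]
  (μ : Measure E) [μ.IsAddHaarMeasure] {φ : E → F}

lemma lintegral_comp_smul (f : E → ℝ≥0∞) {r : ℝ} (hr : r ≠ 0) :
    ∫⁻ x, f (r • x) ∂μ = ENNReal.ofReal |(r ^ Module.finrank ℝ E)⁻¹| * ∫⁻ x, f x ∂μ := by
  have hmap := (measurableEmbedding_const_smul₀ hr).lintegral_map (μ := μ) f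
  rw [← hmap, Measure.map_addHaar_smul μ hr, lintegral_smul_measure, smul_eq_mul]

lemma lintegral_lintegral_ray {G : E → ℝ≥0∞} (hG : Measurable G) :
    ∫⁻ x, (∫⁻ t in Ioi (1 : ℝ),
        ENNReal.ofReal (t ^ (Module.finrank ℝ E / 2 : ℝ)) * G (t • x)) ∂μ =
      (∫⁻ t in Ioi (1 : ℝ), ENNReal.ofReal (t ^ (-(Module.finrank ℝ E / 2) : ℝ))) *
        ∫⁻ x, G x ∂μ := by
  rw [lintegral_lintegral_swap (by fun_prop), ← lintegral_mul_const _ (by fun_prop)]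
  refine setLIntegral_congr_fun measurableSet_Ioi fun t ht => ?_
  have ht0 : 0 < t := one_pos.trans ht
  rw [lintegral_const_mul' _ _ ENNReal.ofReal_ne_top, lintegral_comp_smul μ G ht0.ne', ← mul_assoc,
    ← ENNReal.ofReal_mul (by positivity), abs_of_pos (by positivity), ← Real.rpow_natCast,
    ← Real.rpow_neg ht0.le, ← Real.rpow_add ht0]
  congr 3
  ring

/-- Along each ray `φ x = -∫_1^∞ Dφ(t x) x dt`; the Cauchy–Schwarz inequality with the weight
`t^{-d/2}` is the choice for which both remaining `t`-integrals equal `∫_1^∞ t^{-d/2} dt`. -/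
lemma eLpNorm_inv_norm_smul_le (hφ : ContDiff ℝ 1 φ) (hc : HasCompactSupport φ)
    (hd : 2 < Module.finrank ℝ E) :
    eLpNorm (fun x => ‖x‖⁻¹ • φ x) 2 μ ≤
      ENNReal.ofReal (2 / (Module.finrank ℝ E - 2)) * eLpNorm (fderiv ℝ φ) 2 μ := by
  set s : ℝ := Module.finrank ℝ E / 2 with hs
  have hd' : (2 : ℝ) < Module.finrank ℝ E := by exact_mod_cast hd
  have hK : ∫⁻ t in Ioi (1 : ℝ), ENNReal.ofReal (t ^ (-s)) =
      ENNReal.ofReal (2 / (Module.finrank ℝ E - 2)) := by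
    rw [lintegral_Ioi_one_rpow_neg (by rw [hs]; linarith), hs, inv_eq_one_div,
      div_sub_one two_ne_zero, one_div_div]
  rw [← ENNReal.pow_le_pow_left_iff two_ne_zero, mul_pow, sq_eLpNorm_two, sq_eLpNorm_two, ← hK]
  have hmeas : Measurable fun x => ‖fderiv ℝ φ x‖ₑ ^ 2 :=
    (hφ.continuous_fderiv one_ne_zero).enorm.measurable.pow_const 2
  calc ∫⁻ x, ‖‖x‖⁻¹ • φ x‖ₑ ^ 2 ∂μ
      ≤ ∫⁻ x, ((∫⁻ t in Ioi (1 : ℝ), ENNReal.ofReal (t ^ (-s))) *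
          ∫⁻ t in Ioi (1 : ℝ), ENNReal.ofReal (t ^ s) * ‖fderiv ℝ φ (t • x)‖ₑ ^ 2) ∂μ :=
        lintegral_mono fun x => sq_enorm_inv_norm_smul_le hφ hc x s
    _ = _ := by
        rw [lintegral_const_mul' _ _ (hK ▸ ENNReal.ofReal_ne_top),
          lintegral_lintegral_ray μ hmeas, sq, mul_assoc]

theorem eLpNorm_inv_norm_sub_smul_le (hφ : ContDiff ℝ 1 φ) (hc : HasCompactSupport φ)
    (hd : 2 < Module.finrank ℝ E) (a : E) :
    eLpNorm (fun x => ‖x - a‖⁻¹ • φ x) 2 μ ≤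
      ENNReal.ofReal (2 / (Module.finrank ℝ E - 2)) * eLpNorm (fderiv ℝ φ) 2 μ := by
  have htranslate := measurePreserving_add_right μ a
  have hhardy := eLpNorm_inv_norm_smul_le μ (φ := fun x => φ (x + a)) (hφ.comp (by fun_prop))
    (hc.comp_homeomorph (Homeomorph.addRight a)) hd
  have hfderiv : fderiv ℝ (fun x => φ (x + a)) = fderiv ℝ φ ∘ (· + a) :=
    funext fun x => fderiv_comp_add_right a
  have hφm : AEStronglyMeasurable φ μ := hφ.continuous.aestronglyMeasurable
  have hleft : AEStronglyMeasurable (fun x => ‖x - a‖⁻¹ • φ x) μ :=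
    (by fun_prop : Measurable fun x : E => ‖x - a‖⁻¹).aestronglyMeasurable.smul hφm
  have hright : AEStronglyMeasurable (fderiv ℝ φ) μ :=
    (hφ.continuous_fderiv one_ne_zero).aestronglyMeasurable
  rw [hfderiv, eLpNorm_comp_measurePreserving hright htranslate] at hhardy
  rw [← eLpNorm_comp_measurePreserving hleft htranslate]
  simpa only [Function.comp_def, add_sub_cancel_right] using hhardy

end Hardy

section Translation

variable {E F : Type*} [NormedAddCommGroup E] [NormedSpace ℝ E] [MeasurableSpace E] [BorelSpace E]
  [NormedAddCommGroup F] [NormedSpace ℝ F]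
  (μ : Measure E) [SFinite μ] [μ.IsAddRightInvariant] {φ : E → F}

lemma lintegral_enorm_translate_sub_le (hφ : ContDiff ℝ 1 φ) (y : E) :
    ∫⁻ x, ‖φ (x + y) - φ x‖ₑ ^ 2 ∂μ ≤ ‖y‖ₑ ^ 2 * ∫⁻ x, ‖fderiv ℝ φ x‖ₑ ^ 2 ∂μ := by
  have hmeas : Measurable fun z : E × ℝ => ‖fderiv ℝ φ (z.1 + z.2 • y)‖ₑ :=
    ((hφ.continuous_fderiv one_ne_zero).comp (by fun_prop)).enorm.measurable
  have hpoint (x : E) : ‖φ (x + y) - φ x‖ₑ ^ 2 ≤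
      ‖y‖ₑ ^ 2 * ∫⁻ t in Icc (0 : ℝ) 1, ‖fderiv ℝ φ (x + t • y)‖ₑ ^ 2 := by
    have hseg := enorm_sub_le_lintegral_fderiv_segment hφ x y zero_le_one
    simp only [one_smul, zero_smul, add_zero] at hseg
    refine (pow_le_pow_left' hseg 2).trans ?_
    rw [mul_pow]
    gcongr
    simpa using sq_lintegral_le_measure_mul (μ := volume.restrict (Icc (0 : ℝ) 1))
      (hmeas.comp measurable_prodMk_left).aemeasurable
  calc ∫⁻ x, ‖φ (x + y) - φ x‖ₑ ^ 2 ∂μ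
      ≤ ∫⁻ x, (‖y‖ₑ ^ 2 * ∫⁻ t in Icc (0 : ℝ) 1, ‖fderiv ℝ φ (x + t • y)‖ₑ ^ 2) ∂μ :=
        lintegral_mono hpoint
    _ = ‖y‖ₑ ^ 2 * ∫⁻ t in Icc (0 : ℝ) 1, ∫⁻ x, ‖fderiv ℝ φ (x + t • y)‖ₑ ^ 2 ∂μ := by
        rw [lintegral_const_mul' _ _ (by finiteness),
          lintegral_lintegral_swap (hmeas.pow_const 2).aemeasurable]
    _ = ‖y‖ₑ ^ 2 * ∫⁻ x, ‖fderiv ℝ φ x‖ₑ ^ 2 ∂μ := by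
        simp_rw [lintegral_add_right_eq_self (fun x => ‖fderiv ℝ φ x‖ₑ ^ 2)]
        simp

end Translation

section Weights

variable {N : ℕ} {Ω : Set (Euc N)}

lemma eLpNorm_gradient (φ : Euc N → ℝ) (q : ℝ≥0∞) (μ : Measure (Euc N)) :
    eLpNorm (∇ φ) q μ = eLpNorm (fderiv ℝ φ) q μ :=
  eLpNorm_congr_enorm_ae (Eventually.of_forall fun x => enorm_gradient φ x)

lemma isGradientWeight_one_of_isBounded (hN : 2 < N) (hΩ : Bornology.IsBounded Ω) :
    IsGradientWeight Ω 2 fun _ => 1 := by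
  refine ⟨measurable_const,
    eLpNormLESNormFDerivOfLeConst ℝ (volume : Measure (Euc N)) Ω 2 2, fun φ hφ => ?_⟩
  simp only [one_mul, eLpNorm_gradient]
  exact eLpNorm_le_eLpNorm_fderiv (p := 2) volume hφ.contDiff_one
    ((subset_tsupport φ).trans hφ.tsupport_subset) one_le_two (by simpa using mod_cast hN) hΩ

lemma isGradientWeight_inv_norm_sub (hN : 2 < N) (a : Euc N) :
    IsGradientWeight Ω 2 fun x => ‖x - a‖⁻¹ := by
  refine ⟨by fun_prop, (2 / ((Module.finrank ℝ (Euc N) : ℝ) - 2)).toNNReal, fun φ hφ => ?_⟩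
  rw [eLpNorm_gradient]
  exact eLpNorm_inv_norm_sub_smul_le volume hφ.contDiff_one hφ.hasCompactSupport
    (by simpa using hN) a

end Weights

section Sobolev

variable (N : ℕ) [hN : Fact (3 ≤ N)]

lemma two_lt_twoStar : 2 < twoStar N := by
  have h3 : (3 : ℝ) ≤ N := by exact_mod_cast hN.out
  rw [twoStar, lt_div_iff₀ (by linarith)]
  linarith

lemma inv_twoStar : (twoStar N)⁻¹ = 2⁻¹ - (N : ℝ)⁻¹ := by
  have h3 : (3 : ℝ) ≤ N := by exact_mod_cast hN.out
  have h2 : (N : ℝ) - 2 ≠ 0 := by linarith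
  rw [twoStar]
  field_simp

lemma isGradientWeight_one (Ω : Set (Euc N)) :
    IsGradientWeight Ω (ENNReal.ofReal (twoStar N)) fun _ => 1 := by
  refine ⟨measurable_const,
    eLpNormLESNormFDerivOfEqInnerConst (volume : Measure (Euc N)) 2, fun φ hφ => ?_⟩
  simp only [one_mul, eLpNorm_gradient]
  refine eLpNorm_le_eLpNorm_fderiv_of_eq_inner volume hφ.contDiff_one hφ.hasCompactSupport
    one_le_two ?_ ?_
  · have := hN.out
    simp only [finrank_euclideanSpace, Fintype.card_fin]
    omega
  · rw [Real.coe_toNNReal _ (by linarith [two_lt_twoStar N]), inv_twoStar]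
    simp

end Sobolev

section Homogeneous

variable {p r δ ε C : ℝ} {F : ℝ → ℝ → ℝ}

/-- Positive homogeneity of degree `p` of a function of two real variables. -/
def IsPosHomogeneous (p : ℝ) (F : ℝ → ℝ → ℝ) : Prop :=
  ∀ ⦃t : ℝ⦄, 0 < t → ∀ a b, F (t * a) (t * b) = t ^ p * F a b

lemma IsPosHomogeneous.abs_apply_eq (hF : IsPosHomogeneous p F) {t : ℝ} (ht : 0 < t) (a b : ℝ) :
    |F a b| = t ^ p * |F (a / t) (b / t)| := by
  have h := hF ht (a / t) (b / t)
  rw [mul_div_cancel₀ _ ht.ne', mul_div_cancel₀ _ ht.ne'] at h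
  rw [h, abs_mul, abs_of_pos (Real.rpow_pos_of_pos ht p)]

lemma IsPosHomogeneous.zero_zero (hF : IsPosHomogeneous p F) (hp : 0 < p) : F 0 0 = 0 := by
  have h := hF two_pos 0 0
  have h2 : (1 : ℝ) < 2 ^ p := Real.one_lt_rpow one_lt_two hp
  simp only [mul_zero] at h
  nlinarith

lemma abs_div_abs_self {a : ℝ} (ha : a ≠ 0) : |a / (|a|)| = 1 := by
  rw [abs_div, abs_abs, div_self (abs_ne_zero.2 ha)]

lemma IsPosHomogeneous.abs_le_of_abs_le_mul (hF : IsPosHomogeneous p F)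
    (h : ∀ s, |s| = 1 → ∀ b, |b| ≤ δ → |F s b| ≤ ε * |b| ^ r) {a b : ℝ} (ha : a ≠ 0)
    (hab : |b| ≤ δ * |a|) : |F a b| ≤ ε * (|a| ^ (p - r) * |b| ^ r) := by
  have ha' : 0 < |a| := abs_pos.2 ha
  have hb : |b / (|a|)| ≤ δ := by rwa [abs_div, abs_abs, div_le_iff₀ ha']
  calc |F a b| = |a| ^ p * |F (a / |a|) (b / |a|)| := hF.abs_apply_eq ha' a b
    _ ≤ |a| ^ p * (ε * |b / (|a|)| ^ r) := by gcongr; exact h _ (abs_div_abs_self ha) _ hb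
    _ = ε * (|a| ^ (p - r) * |b| ^ r) := by
      rw [abs_div, abs_abs, Real.div_rpow (abs_nonneg _) (abs_nonneg _), Real.rpow_sub ha']
      field_simp

lemma IsPosHomogeneous.abs_le_of_mul_le_abs (hF : IsPosHomogeneous p F) (hδ : 0 < δ)
    (h : ∀ a s, |a| ≤ δ⁻¹ → |s| = 1 → |F a s| ≤ C) {a b : ℝ} (hb : b ≠ 0)
    (hab : δ * |a| ≤ |b|) : |F a b| ≤ C * |b| ^ p := by
  have hb' : 0 < |b| := abs_pos.2 hb
  have ha : |a / (|b|)| ≤ δ⁻¹ := by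
    rwa [abs_div, abs_abs, div_le_iff₀ hb', le_inv_mul_iff₀ hδ]
  rw [hF.abs_apply_eq hb' a b, mul_comm]
  gcongr
  exact h _ _ ha (abs_div_abs_self hb)

lemma IsPosHomogeneous.exists_abs_le (hF : IsPosHomogeneous p F) (hp : 0 < p)
    (hcont : Continuous (Function.uncurry F))
    (h : ∀ s : ℝ, |s| = 1 → ∀ᶠ b in 𝓝 (0 : ℝ), |F s b| ≤ ε * |b| ^ r) (hε : 0 < ε) :
    ∃ C, 0 ≤ C ∧ ∀ a b, |F a b| ≤ ε * (|a| ^ (p - r) * |b| ^ r) + C * |b| ^ p := by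
  obtain ⟨δ, hδ, hball⟩ := Metric.nhds_basis_closedBall.eventually_iff.1
    ((h 1 abs_one).and (h (-1) (by simp)))
  have hnear : ∀ s : ℝ, |s| = 1 → ∀ b, |b| ≤ δ → |F s b| ≤ ε * |b| ^ r := by
    intro s hs b hb
    have hb' := hball (mem_closedBall_zero_iff.2 hb)
    rcases (abs_eq zero_le_one).1 hs with rfl | rfl
    exacts [hb'.1, hb'.2]
  obtain ⟨C, hC⟩ := ((isCompact_closedBall (0 : ℝ) δ⁻¹).prod
    (isCompact_sphere (0 : ℝ) 1)).exists_bound_of_continuousOn hcont.continuousOn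
  have hfar : ∀ a s : ℝ, |a| ≤ δ⁻¹ → |s| = 1 → |F a s| ≤ C := fun a s ha hs =>
    hC (a, s) ⟨mem_closedBall_zero_iff.2 ha, mem_sphere_zero_iff_norm.2 hs⟩
  have hC0 : 0 ≤ C := (abs_nonneg _).trans (hfar 0 1 (by simpa using hδ.le) abs_one)
  refine ⟨C, hC0, fun a b => ?_⟩
  have hnn₁ : 0 ≤ C * |b| ^ p := by positivity
  have hnn₂ : 0 ≤ ε * (|a| ^ (p - r) * |b| ^ r) := by positivity
  by_cases hab : a ≠ 0 ∧ |b| ≤ δ * |a|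
  · exact (hF.abs_le_of_abs_le_mul hnear hab.1 hab.2).trans (le_add_of_nonneg_right hnn₁)
  rcases eq_or_ne b 0 with rfl | hb
  · have ha : a = 0 := by
      by_contra ha
      exact hab ⟨ha, by rw [abs_zero]; positivity⟩
    subst ha
    simpa only [hF.zero_zero hp, abs_zero] using add_nonneg hnn₂ hnn₁
  · refine (hF.abs_le_of_mul_le_abs hδ hfar hb ?_).trans (le_add_of_nonneg_left hnn₂)
    rcases eq_or_ne a 0 with rfl | ha
    · simp
    · exact (not_le.1 fun h' => hab ⟨ha, h'⟩).le

end Homogeneous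

section SignedPower

variable {p : ℝ}

/-- The signed power `|a|^{p-2} a`, whose primitive is `|a|^p / p`. -/
noncomputable def signedPow (p a : ℝ) : ℝ := |a| ^ (p - 2) * a

lemma continuous_signedPow (hp : 1 < p) : Continuous (signedPow p) := by
  have h := ((contDiff_norm_rpow (E := ℝ) hp).continuous_deriv le_rfl).const_mul p⁻¹
  refine h.congr fun a => ?_
  rw [(hasDerivAt_norm_rpow a hp).deriv, mul_assoc, inv_mul_cancel_left₀ (by linarith)]
  rfl

lemma continuous_abs_rpow (hp : 0 < p) : Continuous fun a : ℝ => |a| ^ p :=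
  continuous_abs.rpow_const fun _ => Or.inr hp.le

lemma signedPow_mul_self (hp : 0 < p) (a : ℝ) : signedPow p a * a = |a| ^ p := by
  rcases eq_or_ne a 0 with rfl | ha
  · simp [Real.zero_rpow hp.ne']
  rw [signedPow, mul_assoc, ← sq, ← sq_abs, ← Real.rpow_natCast, ← Real.rpow_add (abs_pos.2 ha)]
  norm_num

lemma abs_signedPow (hp : 1 < p) (a : ℝ) : |signedPow p a| = |a| ^ (p - 1) := by
  rcases eq_or_ne a 0 with rfl | ha
  · simp [signedPow, Real.zero_rpow (by linarith : p - 1 ≠ 0)]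
  rw [signedPow, abs_mul, abs_of_nonneg (by positivity : 0 ≤ |a| ^ (p - 2)),
    ← Real.rpow_add_one (abs_pos.2 ha).ne']
  ring_nf

lemma abs_mul_rpow_of_pos {t : ℝ} (ht : 0 < t) (a : ℝ) : |t * a| ^ p = t ^ p * |a| ^ p := by
  rw [abs_mul, abs_of_pos ht, Real.mul_rpow ht.le (abs_nonneg _)]

lemma signedPow_mul_mul {t : ℝ} (ht : 0 < t) (a b : ℝ) :
    signedPow p (t * a) * (t * b) = t ^ p * (signedPow p a * b) := by
  have h : t ^ p = t ^ (p - 2) * t ^ 2 := by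
    rw [← Real.rpow_natCast, ← Real.rpow_add ht]
    norm_num
  rw [signedPow, abs_mul_rpow_of_pos ht, h, signedPow]
  ring

lemma exists_abs_rpow_taylor_le (hp : 1 < p) {ε : ℝ} (hε : 0 < ε) :
    ∃ C, 0 ≤ C ∧ ∀ a b : ℝ, |(|a + b| ^ p - |a| ^ p - p * (signedPow p a * b))| ≤
      ε * (|a| ^ (p - 1) * |b|) + C * |b| ^ p := by
  have hp0 : 0 < p := by linarith
  have hsigned := continuous_signedPow hp
  have hF : IsPosHomogeneous p fun a b => |a + b| ^ p - |a| ^ p - p * (signedPow p a * b) :=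
    fun t ht a b => by
      simp only [← mul_add, abs_mul_rpow_of_pos ht, signedPow_mul_mul ht]
      ring
  have hcont : Continuous (Function.uncurry fun a b : ℝ =>
      |a + b| ^ p - |a| ^ p - p * (signedPow p a * b)) := by
    unfold Function.uncurry
    fun_prop (disch := linarith)
  have h := hF.exists_abs_le (r := 1) hp0 hcont (fun s _ => ?_) hε
  · simpa using h
  · have hderiv := hasDerivAt_abs_rpow s hp
    filter_upwards [(hasDerivAt_iff_isLittleO_nhds_zero.1 hderiv).def hε] with b hb
    simpa [signedPow, mul_comm, mul_left_comm, mul_assoc] using hb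

end SignedPower

section EpsilonDomination

variable {α : Type*} [MeasurableSpace α] {μ : Measure α} {f g : ℕ → α → ℝ} {G : α → ℝ}

lemma integrable_max_abs_sub_zero {f g : α → ℝ} (hf : AEStronglyMeasurable f μ)
    (hg : AEStronglyMeasurable g μ) (hG : Integrable G μ) (hb : ∀ᵐ x ∂μ, |f x| ≤ g x + G x) :
    Integrable (fun x => max (|f x| - g x) 0) μ := by
  refine hG.abs.mono' ((hf.norm.sub hg).sup aestronglyMeasurable_const) ?_
  filter_upwards [hb] with x hx
  rw [Real.norm_of_nonneg (le_max_right _ _)]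
  exact max_le ((sub_le_iff_le_add'.2 hx).trans (le_abs_self _)) (abs_nonneg _)

lemma tendsto_integral_max_abs_sub_zero (hf : ∀ n, AEStronglyMeasurable (f n) μ)
    (hg : ∀ n, AEStronglyMeasurable (g n) μ) (hg0 : ∀ n x, 0 ≤ g n x) (hG : Integrable G μ)
    (hb : ∀ n, ∀ᵐ x ∂μ, |f n x| ≤ g n x + G x)
    (hlim : ∀ᵐ x ∂μ, Tendsto (fun n => f n x) atTop (𝓝 0)) :
    Tendsto (fun n => ∫ x, max (|f n x| - g n x) 0 ∂μ) atTop (𝓝 0) := by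
  rw [show (𝓝 (0 : ℝ)) = 𝓝 (∫ _, (0 : ℝ) ∂μ) by rw [integral_zero]]
  refine tendsto_integral_of_dominated_convergence (fun x => |G x|)
    (fun n => (integrable_max_abs_sub_zero (hf n) (hg n) hG (hb n)).1) hG.abs (fun n => ?_) ?_
  · filter_upwards [hb n] with x hx
    rw [Real.norm_of_nonneg (le_max_right _ _)]
    exact max_le ((sub_le_iff_le_add'.2 hx).trans (le_abs_self _)) (abs_nonneg _)
  · filter_upwards [hlim] with x hx
    exact squeeze_zero (fun n => le_max_right _ _)
      (fun n => max_le (sub_le_self _ (hg0 n x)) (abs_nonneg _)) (by simpa using hx.abs)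

lemma tendsto_integral_of_eps_dominated {M : ℝ} (hf : ∀ n, AEStronglyMeasurable (f n) μ)
    (hg : ∀ n, Integrable (g n) μ) (hg0 : ∀ n x, 0 ≤ g n x) (hM : ∀ n, ∫ x, g n x ∂μ ≤ M)
    (hG : Integrable G μ)
    (hb : ∀ ε > 0, ∃ C, ∀ n, ∀ᵐ x ∂μ, |f n x| ≤ ε * g n x + C * G x)
    (hlim : ∀ᵐ x ∂μ, Tendsto (fun n => f n x) atTop (𝓝 0)) :
    Tendsto (fun n => ∫ x, f n x ∂μ) atTop (𝓝 0) := by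
  have hM0 : 0 ≤ M := (integral_nonneg (hg0 0)).trans (hM 0)
  refine squeeze_zero_norm (fun n => abs_integral_le_integral_abs) ?_
  rw [tendsto_order]
  refine ⟨fun c hc => Eventually.of_forall fun n =>
    hc.trans_le (integral_nonneg fun x => abs_nonneg _), fun ε hε => ?_⟩
  set η : ℝ := ε / (2 * (M + 1)) with hη
  have hη0 : 0 < η := by positivity
  obtain ⟨C, hC⟩ := hb η hη0
  have hηg : ∀ n, Integrable (fun x => η * g n x) μ := fun n => (hg n).const_mul η
  filter_upwards [(tendsto_integral_max_abs_sub_zero hf (fun n => (hηg n).1)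
    (fun n x => mul_nonneg hη0.le (hg0 n x)) (hG.const_mul C) hC hlim).eventually
    (gt_mem_nhds (half_pos hε))] with n hn
  have hmax := integrable_max_abs_sub_zero (hf n) (hηg n).1 (hG.const_mul C) (hC n)
  calc ∫ x, |f n x| ∂μ ≤ ∫ x, (max (|f n x| - η * g n x) 0 + η * g n x) ∂μ :=
      integral_mono_of_nonneg (Eventually.of_forall fun x => abs_nonneg _) (hmax.add (hηg n))
        (Eventually.of_forall fun x => sub_le_iff_le_add.1 (le_max_left _ _))
    _ = ∫ x, max (|f n x| - η * g n x) 0 ∂μ + η * ∫ x, g n x ∂μ := by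
      rw [integral_add hmax (hηg n), integral_const_mul]
    _ < ε / 2 + η * (M + 1) :=
      add_lt_add_of_lt_of_le hn (by gcongr; linarith [hM n])
    _ = ε := by rw [hη]; field_simp; norm_num

end EpsilonDomination

section PowerFunctional

variable {α : Type*} [MeasurableSpace α] {μ : Measure α} {p : ℝ}

lemma integrable_abs_rpow (hp : 0 < p) (u : Lp ℝ (ENNReal.ofReal p) μ) :
    Integrable (fun x => |u x| ^ p) μ := by
  have h := (Lp.memLp u).integrable_norm_rpow (by simpa using hp) ENNReal.ofReal_ne_top
  rwa [ENNReal.toReal_ofReal hp.le] at h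

lemma integral_abs_rpow (hp : 0 < p) (u : Lp ℝ (ENNReal.ofReal p) μ) :
    ∫ x, |u x| ^ p ∂μ = ‖u‖ ^ p := by
  have h0 : 0 ≤ ∫ x, |u x| ^ p ∂μ := integral_nonneg fun x => by positivity
  rw [Lp.norm_def, (Lp.memLp u).eLpNorm_eq_integral_rpow_norm (by simpa using hp)
    ENNReal.ofReal_ne_top, ENNReal.toReal_ofReal (by positivity), ENNReal.toReal_ofReal hp.le]
  simp only [Real.norm_eq_abs]
  rw [Real.rpow_inv_rpow h0 hp.ne']

lemma memLp_abs_rpow_sub_one (hp : 1 < p) (u : Lp ℝ (ENNReal.ofReal p) μ) :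
    MemLp (fun x => |u x| ^ (p - 1)) (ENNReal.ofReal (p / (p - 1))) μ := by
  have hq : 0 < p / (p - 1) := div_pos (by linarith) (by linarith)
  rw [← integrable_norm_rpow_iff _ (by simpa using hq) ENNReal.ofReal_ne_top,
    ENNReal.toReal_ofReal hq.le]
  · refine (integrable_abs_rpow (by linarith) u).congr (Eventually.of_forall fun x => ?_)
    simp only
    rw [Real.norm_of_nonneg (by positivity), ← Real.rpow_mul (abs_nonneg _),
      mul_div_cancel₀ _ (by linarith)]
  · exact (continuous_abs_rpow (by linarith)).comp_aestronglyMeasurable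
      (Lp.aestronglyMeasurable u)

lemma integrable_abs_rpow_sub_one_mul (hp : 1 < p) (u v : Lp ℝ (ENNReal.ofReal p) μ) :
    Integrable (fun x => |u x| ^ (p - 1) * |v x|) μ := by
  have : (ENNReal.ofReal (p / (p - 1))).HolderConjugate (ENNReal.ofReal p) :=
    (Real.HolderConjugate.conjExponent hp).symm.ennrealOfReal
  exact (memLp_abs_rpow_sub_one hp u).integrable_mul (Lp.memLp v).abs

lemma integral_abs_rpow_sub_one_mul_le (hp : 1 < p) (u v : Lp ℝ (ENNReal.ofReal p) μ) :
    ∫ x, |u x| ^ (p - 1) * |v x| ∂μ ≤ ‖u‖ ^ (p - 1) * ‖v‖ := by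
  have hp0 : 0 < p := by linarith
  have hnorm : ∀ w : Lp ℝ (ENNReal.ofReal p) μ, 0 ≤ ‖w‖ := fun w => by
    rw [Lp.norm_def]; positivity
  refine (integral_mul_le_Lp_mul_Lq_of_nonneg (Real.HolderConjugate.conjExponent hp).symm
    (f := fun x => |u x| ^ (p - 1)) (g := fun x => |v x|)
    (Eventually.of_forall fun _ => by positivity) (Eventually.of_forall fun _ => abs_nonneg _)
    (memLp_abs_rpow_sub_one hp u) (Lp.memLp v).abs).trans_eq ?_
  have hpow : ∀ x, (|u x| ^ (p - 1)) ^ p.conjExponent = |u x| ^ p := fun x => by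
    rw [← Real.rpow_mul (abs_nonneg _), Real.conjExponent, mul_div_cancel₀ _ (by linarith)]
  simp only [hpow]
  rw [integral_abs_rpow hp0, integral_abs_rpow hp0, ← Real.rpow_mul (hnorm u),
    ← Real.rpow_mul (hnorm v), mul_one_div_cancel hp0.ne', Real.rpow_one, Real.conjExponent]
  congr 2
  field_simp

lemma norm_signedPow_mul (hp : 1 < p) (a b : ℝ) :
    ‖signedPow p a * b‖ = |a| ^ (p - 1) * |b| := by
  rw [norm_mul, Real.norm_eq_abs, Real.norm_eq_abs, abs_signedPow hp]

lemma integrable_signedPow_mul (hp : 1 < p) (u v : Lp ℝ (ENNReal.ofReal p) μ) :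
    Integrable (fun x => signedPow p (u x) * v x) μ :=
  (integrable_abs_rpow_sub_one_mul hp u v).mono'
    (((continuous_signedPow hp).comp_aestronglyMeasurable (Lp.aestronglyMeasurable u)).mul
      (Lp.aestronglyMeasurable v))
    (Eventually.of_forall fun _ => (norm_signedPow_mul hp _ _).le)

variable [Fact (1 ≤ ENNReal.ofReal p)]

/-- The functional `v ↦ ∫ |u|^{p-2} u v` on `L^p`; it is the derivative of `‖·‖^p / p` at `u`. -/
noncomputable def powerCLM (hp : 1 < p) (u : Lp ℝ (ENNReal.ofReal p) μ) :
    Lp ℝ (ENNReal.ofReal p) μ →L[ℝ] ℝ :=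
  LinearMap.mkContinuous
    { toFun := fun v => ∫ x, signedPow p (u x) * v x ∂μ
      map_add' := fun v w => by
        rw [← integral_add (integrable_signedPow_mul hp u v) (integrable_signedPow_mul hp u w)]
        refine integral_congr_ae ?_
        filter_upwards [Lp.coeFn_add v w] with x hx
        rw [hx, Pi.add_apply, mul_add]
      map_smul' := fun c v => by
        rw [RingHom.id_apply, smul_eq_mul, ← integral_const_mul]
        refine integral_congr_ae ?_
        filter_upwards [Lp.coeFn_smul c v] with x hx
        rw [hx, Pi.smul_apply, smul_eq_mul, mul_left_comm] }
    (‖u‖ ^ (p - 1)) fun v => by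
      refine (norm_integral_le_integral_norm _).trans ?_
      simp only [norm_signedPow_mul hp]
      exact integral_abs_rpow_sub_one_mul_le hp u v

lemma powerCLM_apply (hp : 1 < p) (u v : Lp ℝ (ENNReal.ofReal p) μ) :
    powerCLM hp u v = ∫ x, signedPow p (u x) * v x ∂μ := rfl

lemma powerCLM_apply_self (hp : 1 < p) (u : Lp ℝ (ENNReal.ofReal p) μ) :
    powerCLM hp u u = ‖u‖ ^ p := by
  simp only [powerCLM_apply, signedPow_mul_self (by linarith : 0 < p)]
  exact integral_abs_rpow (by linarith) u

lemma norm_add_rpow_sub_sub_powerCLM (hp : 1 < p) (u v : Lp ℝ (ENNReal.ofReal p) μ) :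
    ‖u + v‖ ^ p - ‖u‖ ^ p - (p • powerCLM hp u) v =
      ∫ x, (|u x + v x| ^ p - |u x| ^ p - p * (signedPow p (u x) * v x)) ∂μ := by
  have hp0 : 0 < p := by linarith
  have hadd : (fun x => |(u + v) x| ^ p) =ᵐ[μ] fun x => |u x + v x| ^ p := by
    filter_upwards [Lp.coeFn_add u v] with x hx
    rw [hx, Pi.add_apply]
  have hint : Integrable (fun x => |u x + v x| ^ p) μ :=
    (integrable_abs_rpow hp0 (u + v)).congr hadd
  rw [integral_sub (f := fun x => |u x + v x| ^ p - |u x| ^ p)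
    (hint.sub (integrable_abs_rpow hp0 u)) ((integrable_signedPow_mul hp u v).const_mul p),
    integral_sub hint (integrable_abs_rpow hp0 u), ← integral_congr_ae hadd, integral_abs_rpow hp0,
    integral_abs_rpow hp0, integral_const_mul]
  rfl

lemma exists_abs_norm_add_rpow_sub_le (hp : 1 < p) {ε : ℝ} (hε : 0 < ε) :
    ∃ C, 0 ≤ C ∧ ∀ u v : Lp ℝ (ENNReal.ofReal p) μ,
      ‖‖u + v‖ ^ p - ‖u‖ ^ p - (p • powerCLM hp u) v‖ ≤
        (ε * ‖u‖ ^ (p - 1) + C * ‖v‖ ^ (p - 1)) * ‖v‖ := by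
  have hp0 : 0 < p := by linarith
  obtain ⟨C, hC0, hC⟩ := exists_abs_rpow_taylor_le hp hε
  refine ⟨C, hC0, fun u v => ?_⟩
  have hi₁ := (integrable_abs_rpow_sub_one_mul hp u v).const_mul ε
  have hi₂ := (integrable_abs_rpow hp0 v).const_mul C
  rw [norm_add_rpow_sub_sub_powerCLM]
  calc _ ≤ ∫ x, (ε * (|u x| ^ (p - 1) * |v x|) + C * |v x| ^ p) ∂μ :=
        norm_integral_le_of_norm_le (hi₁.add hi₂) (Eventually.of_forall fun x => hC _ _)
    _ = ε * ∫ x, |u x| ^ (p - 1) * |v x| ∂μ + C * ‖v‖ ^ p := by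
      rw [integral_add hi₁ hi₂, integral_const_mul, integral_const_mul, integral_abs_rpow hp0]
    _ ≤ ε * (‖u‖ ^ (p - 1) * ‖v‖) + C * (‖v‖ ^ (p - 1) * ‖v‖) := by
      rw [← Real.rpow_add_one' (norm_nonneg v) (by linarith), sub_add_cancel]
      gcongr
      exact integral_abs_rpow_sub_one_mul_le hp u v
    _ = (ε * ‖u‖ ^ (p - 1) + C * ‖v‖ ^ (p - 1)) * ‖v‖ := by ring

lemma hasFDerivAt_norm_rpow_Lp (hp : 1 < p) (u : Lp ℝ (ENNReal.ofReal p) μ) :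
    HasFDerivAt (fun u : Lp ℝ (ENNReal.ofReal p) μ => ‖u‖ ^ p) (p • powerCLM hp u) u := by
  rw [hasFDerivAt_iff_isLittleO_nhds_zero, Asymptotics.isLittleO_iff]
  intro ε hε
  set η : ℝ := ε / (‖u‖ ^ (p - 1) + 1) with hη
  obtain ⟨C, -, hC⟩ := exists_abs_norm_add_rpow_sub_le (μ := μ) hp (by positivity : 0 < η)
  have hlim : Tendsto (fun v : Lp ℝ (ENNReal.ofReal p) μ =>
      η * ‖u‖ ^ (p - 1) + C * ‖v‖ ^ (p - 1)) (𝓝 0) (𝓝 (η * ‖u‖ ^ (p - 1))) := by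
    have h := ((continuous_norm (E := Lp ℝ (ENNReal.ofReal p) μ)).rpow_const
      (p := p - 1) fun _ => Or.inr (by linarith)).tendsto 0
    simpa [Real.zero_rpow (by linarith : p - 1 ≠ 0)] using
      (h.const_mul C).const_add (η * ‖u‖ ^ (p - 1))
  have hlt : η * ‖u‖ ^ (p - 1) < ε := by
    rw [hη, div_mul_eq_mul_div, div_lt_iff₀ (by positivity)]
    linarith
  filter_upwards [hlim.eventually (ge_mem_nhds hlt)] with v hv
  exact (hC u v).trans (by gcongr)

/-- The common core of the Brezis-Lieb lemma and of its variant for the derivative of `‖·‖^p`. -/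
lemma tendsto_integral_posHomogeneous {F : ℝ → ℝ → ℝ} (hF : IsPosHomogeneous p F) (hp : 0 < p)
    (hcont : Continuous (Function.uncurry F)) (hF₁ : ∀ a, F a 0 = 0) (hF₂ : ∀ b, F 0 b = 0)
    {f : ℕ → Lp ℝ (ENNReal.ofReal p) μ} {M : ℝ} (hM : ∀ n, ‖f n‖ ≤ M)
    (hae : ∀ᵐ x ∂μ, Tendsto (fun n => f n x) atTop (𝓝 0)) (g : Lp ℝ (ENNReal.ofReal p) μ) :
    Tendsto (fun n => ∫ x, F (f n x) (g x) ∂μ) atTop (𝓝 0) := by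
  refine tendsto_integral_of_eps_dominated (g := fun n x => |f n x| ^ p) (M := M ^ p)
    (fun n => hcont.comp_aestronglyMeasurable
      ((Lp.aestronglyMeasurable (f n)).prodMk (Lp.aestronglyMeasurable g)))
    (fun n => integrable_abs_rpow hp (f n)) (fun n x => by positivity)
    (fun n => ?_) (integrable_abs_rpow hp g) (fun ε hε => ?_) ?_
  · rw [integral_abs_rpow hp]
    gcongr
    exact hM n
  · have hsmall : ∀ s : ℝ, |s| = 1 → ∀ᶠ b in 𝓝 (0 : ℝ), |F s b| ≤ ε * |b| ^ (0 : ℝ) := by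
      intro s _
      have h := (hcont.comp (Continuous.prodMk_right s)).abs.tendsto 0
      simp only [Function.comp_apply, Function.uncurry_apply_pair, hF₁, abs_zero] at h
      simpa using h.eventually (ge_mem_nhds hε)
    obtain ⟨C, -, hC⟩ := hF.exists_abs_le hp hcont hsmall hε
    exact ⟨C, fun n => Eventually.of_forall fun x => by simpa using hC (f n x) (g x)⟩
  · filter_upwards [hae] with x hx
    have h := ((hcont.comp (Continuous.prodMk_left (g x))).tendsto 0).comp hx
    simpa only [Function.comp_def, Function.uncurry_apply_pair, hF₂] using h

lemma brezis_lieb (hp : 0 < p) {f : ℕ → Lp ℝ (ENNReal.ofReal p) μ} {M : ℝ}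
    (hM : ∀ n, ‖f n‖ ≤ M) (hae : ∀ᵐ x ∂μ, Tendsto (fun n => f n x) atTop (𝓝 0))
    (g : Lp ℝ (ENNReal.ofReal p) μ) :
    Tendsto (fun n => ‖f n + g‖ ^ p - ‖f n‖ ^ p) atTop (𝓝 (‖g‖ ^ p)) := by
  have hF : IsPosHomogeneous p fun a b => |a + b| ^ p - |a| ^ p - |b| ^ p := fun t ht a b => by
    simp only [← mul_add, abs_mul_rpow_of_pos ht]
    ring
  have hcont : Continuous (Function.uncurry fun a b : ℝ => |a + b| ^ p - |a| ^ p - |b| ^ p) := by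
    unfold Function.uncurry
    fun_prop (disch := linarith)
  have h := (tendsto_integral_posHomogeneous hF hp hcont
    (fun a => by simp [Real.zero_rpow hp.ne']) (fun b => by simp [Real.zero_rpow hp.ne'])
    hM hae g).add_const (‖g‖ ^ p)
  rw [zero_add] at h
  refine h.congr fun n => ?_
  have hadd : (fun x => |(f n + g) x| ^ p) =ᵐ[μ] fun x => |f n x + g x| ^ p := by
    filter_upwards [Lp.coeFn_add (f n) g] with x hx
    rw [hx, Pi.add_apply]
  have hi := (integrable_abs_rpow hp (f n + g)).congr hadd
  rw [integral_sub (f := fun x => |f n x + g x| ^ p - |f n x| ^ p)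
    (hi.sub (integrable_abs_rpow hp _)) (integrable_abs_rpow hp g),
    integral_sub hi (integrable_abs_rpow hp _), ← integral_congr_ae hadd,
    integral_abs_rpow hp, integral_abs_rpow hp, integral_abs_rpow hp, sub_add_cancel]

lemma brezis_lieb_powerCLM (hp : 1 < p) {f : ℕ → Lp ℝ (ENNReal.ofReal p) μ} {M : ℝ}
    (hM : ∀ n, ‖f n‖ ≤ M) (hae : ∀ᵐ x ∂μ, Tendsto (fun n => f n x) atTop (𝓝 0))
    (g : Lp ℝ (ENNReal.ofReal p) μ) :
    Tendsto (fun n => powerCLM hp (f n + g) (f n) - ‖f n‖ ^ p) atTop (𝓝 0) := by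
  have hp0 : 0 < p := by linarith
  have hsigned := continuous_signedPow hp
  have hF : IsPosHomogeneous p fun a b => signedPow p (a + b) * a - |a| ^ p := fun t ht a b => by
    simp only [← mul_add, abs_mul_rpow_of_pos ht, signedPow_mul_mul ht]
    ring
  have hcont : Continuous (Function.uncurry fun a b : ℝ => signedPow p (a + b) * a - |a| ^ p) := by
    unfold Function.uncurry
    fun_prop (disch := linarith)
  refine (tendsto_integral_posHomogeneous hF hp0 hcont
    (fun a => by simp [signedPow_mul_self hp0]) (fun b => by simp [Real.zero_rpow hp0.ne'])
    hM hae g).congr fun n => ?_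
  have hadd : (fun x => signedPow p ((f n + g) x) * f n x) =ᵐ[μ]
      fun x => signedPow p (f n x + g x) * f n x := by
    filter_upwards [Lp.coeFn_add (f n) g] with x hx
    rw [hx, Pi.add_apply]
  rw [integral_sub ((integrable_signedPow_mul hp (f n + g) (f n)).congr hadd)
    (integrable_abs_rpow hp0 _), ← integral_congr_ae hadd, integral_abs_rpow hp0, powerCLM_apply]

end PowerFunctional

section WeakCompactness

lemma exists_subseq_forall_tendsto_apply {E : Type*} [NormedAddCommGroup E]
    [InnerProductSpace ℝ E] [CompleteSpace E] [TopologicalSpace.SeparableSpace E] {u : ℕ → E}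
    {M : ℝ} (hu : ∀ n, ‖u n‖ ≤ M) :
    ∃ σ : ℕ → ℕ, StrictMono σ ∧ ∃ v : E, ∀ ℓ : E →L[ℝ] ℝ,
      Tendsto (fun n => ℓ (u (σ n))) atTop (𝓝 (ℓ v)) := by
  let D := InnerProductSpace.toDual ℝ E
  obtain ⟨f, -, σ, hσ, hlim⟩ := WeakDual.isSeqCompact_closedBall ℝ E 0 M
    (x := fun n => StrongDual.toWeakDual (D (u n))) fun n => by
      change D (u n) ∈ Metric.closedBall 0 M
      simpa using hu n
  refine ⟨σ, hσ, D.symm (WeakDual.toStrongDual f), fun ℓ => ?_⟩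
  have heval (z : E) : ℓ z = D z (D.symm ℓ) := by
    rw [InnerProductSpace.toDual_apply_apply, real_inner_comm, InnerProductSpace.toDual_symm_apply]
  simp only [heval, D.apply_symm_apply]
  exact (WeakBilin.tendsto_iff_forall_eval_tendsto _ ContinuousLinearMap.coe_injective).1
    hlim (D.symm ℓ)

end WeakCompactness

section Averages

variable {α F : Type*} [MeasurableSpace α] [NormedAddCommGroup F] [NormedSpace ℝ F]

lemma sq_enorm_integral_le {ν : Measure α} [IsProbabilityMeasure ν] {f : α → F}
    (hf : AEStronglyMeasurable f ν) : ‖∫ y, f y ∂ν‖ₑ ^ 2 ≤ ∫⁻ y, ‖f y‖ₑ ^ 2 ∂ν := by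
  calc ‖∫ y, f y ∂ν‖ₑ ^ 2 ≤ (∫⁻ y, ‖f y‖ₑ ∂ν) ^ 2 := by
        gcongr
        exact enorm_integral_le_lintegral_enorm _
    _ ≤ ∫⁻ y, ‖f y‖ₑ ^ 2 ∂ν := by simpa using sq_lintegral_le_measure_mul hf.enorm

variable {E : Type*} [NormedAddCommGroup E] [NormedSpace ℝ E] [MeasurableSpace E] [BorelSpace E]
  {φ : E → F}

lemma eLpNorm_integral_translate_sub_le [SecondCountableTopology E] [CompleteSpace F]
    {ν : Measure E} [IsProbabilityMeasure ν] {r : ℝ≥0∞} (hν : ∀ᵐ y ∂ν, ‖y‖ₑ ≤ r)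
    (μ : Measure E) [SFinite μ] [μ.IsAddRightInvariant] (hφ : ContDiff ℝ 1 φ)
    (hc : HasCompactSupport φ) :
    eLpNorm (fun x => (∫ y, φ (x + y) ∂ν) - φ x) 2 μ ≤ r * eLpNorm (fderiv ℝ φ) 2 μ := by
  have hmeas : Measurable fun z : E × E => ‖φ (z.1 + z.2) - φ z.1‖ₑ ^ 2 :=
    (Continuous.enorm (by have := hφ.continuous; fun_prop)).measurable.pow_const 2
  have hint (x : E) : Integrable (fun y => φ (x + y)) ν := by
    obtain ⟨C, hC⟩ := hφ.continuous.bounded_above_of_compact_support hc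
    exact .of_bound (hφ.continuous.comp (by fun_prop)).aestronglyMeasurable C (by simp [hC])
  have hpoint (x : E) : ‖(∫ y, φ (x + y) ∂ν) - φ x‖ₑ ^ 2 ≤
      ∫⁻ y, ‖φ (x + y) - φ x‖ₑ ^ 2 ∂ν := by
    have hsub : (∫ y, φ (x + y) ∂ν) - φ x = ∫ y, (φ (x + y) - φ x) ∂ν := by
      simp [integral_sub (hint x) (integrable_const _)]
    rw [hsub]
    exact sq_enorm_integral_le ((hint x).sub (integrable_const _)).aestronglyMeasurable
  rw [← ENNReal.pow_le_pow_left_iff two_ne_zero, mul_pow, sq_eLpNorm_two, sq_eLpNorm_two]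
  calc ∫⁻ x, ‖(∫ y, φ (x + y) ∂ν) - φ x‖ₑ ^ 2 ∂μ
      ≤ ∫⁻ x, (∫⁻ y, ‖φ (x + y) - φ x‖ₑ ^ 2 ∂ν) ∂μ := lintegral_mono hpoint
    _ = ∫⁻ y, (∫⁻ x, ‖φ (x + y) - φ x‖ₑ ^ 2 ∂μ) ∂ν := lintegral_lintegral_swap hmeas.aemeasurable
    _ ≤ ∫⁻ _, r ^ 2 * (∫⁻ x, ‖fderiv ℝ φ x‖ₑ ^ 2 ∂μ) ∂ν := by
      refine lintegral_mono_ae (hν.mono fun y hy => ?_)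
      exact (lintegral_enorm_translate_sub_le μ hφ y).trans (by gcongr)
    _ = r ^ 2 * ∫⁻ x, ‖fderiv ℝ φ x‖ₑ ^ 2 ∂μ := by simp

variable [FiniteDimensional ℝ E] (μ : Measure E) [μ.IsAddHaarMeasure] {r : ℝ}

omit [NormedSpace ℝ E] [FiniteDimensional ℝ E] in
lemma setAverage_ball_eq_integral_cond (φ : E → F) (x : E) (r : ℝ) :
    ⨍ y in Metric.ball x r, φ y ∂μ =
      ∫ y, φ (x + y) ∂ProbabilityTheory.cond μ (Metric.ball 0 r) := by
  have hball : Metric.ball (0 : E) r = (x + ·) ⁻¹' Metric.ball x r := by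
    ext y
    simp
  rw [ProbabilityTheory.cond, integral_smul_measure, ENNReal.toReal_inv, setAverage_eq, hball,
    (measurePreserving_add_left μ x).setIntegral_preimage_emb (measurableEmbedding_addLeft x) φ,
    ← hball, measureReal_def, Measure.addHaar_ball_center]

omit [BorelSpace E] in
lemma isProbabilityMeasure_cond_ball (hr : 0 < r) :
    IsProbabilityMeasure (ProbabilityTheory.cond μ (Metric.ball 0 r)) :=
  ProbabilityTheory.cond_isProbabilityMeasure_of_finite
    (Metric.measure_ball_pos μ 0 hr).ne' measure_ball_lt_top.ne

lemma stronglyMeasurable_setAverage_ball (hφ : Continuous φ) [SecondCountableTopology F] (r : ℝ) :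
    StronglyMeasurable fun x => ⨍ y in Metric.ball x r, φ y ∂μ := by
  simp only [setAverage_ball_eq_integral_cond]
  exact StronglyMeasurable.integral_prod_right (f := fun x y => φ (x + y))
    (hφ.comp continuous_add).stronglyMeasurable

lemma sq_enorm_setAverage_ball_le (hφ : Continuous φ) [SecondCountableTopology F] (x : E)
    (hr : 0 < r) : ‖⨍ y in Metric.ball x r, φ y ∂μ‖ₑ ^ 2 ≤
      (μ (Metric.ball 0 r))⁻¹ * eLpNorm φ 2 μ ^ 2 := by
  have := isProbabilityMeasure_cond_ball μ hr
  rw [setAverage_ball_eq_integral_cond]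
  refine (sq_enorm_integral_le (hφ.comp (by fun_prop)).aestronglyMeasurable).trans ?_
  rw [ProbabilityTheory.cond, lintegral_smul_measure, sq_eLpNorm_two, smul_eq_mul]
  gcongr (_)⁻¹ * ?_
  exact (setLIntegral_le_lintegral _ _).trans_eq
    (lintegral_add_left_eq_self (μ := μ) (fun y => ‖φ y‖ₑ ^ 2) x)

lemma eLpNorm_setAverage_ball_sub_le [CompleteSpace F] (hφ : ContDiff ℝ 1 φ)
    (hc : HasCompactSupport φ) (hr : 0 < r) :
    eLpNorm (fun x => (⨍ y in Metric.ball x r, φ y ∂μ) - φ x) 2 μ ≤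
      ENNReal.ofReal r * eLpNorm (fderiv ℝ φ) 2 μ := by
  have := isProbabilityMeasure_cond_ball μ hr
  simp only [setAverage_ball_eq_integral_cond]
  refine eLpNorm_integral_translate_sub_le ?_ μ hφ hc
  refine (ProbabilityTheory.ae_cond_mem measurableSet_ball).mono fun y hy => ?_
  rw [← ofReal_norm]
  exact ENNReal.ofReal_le_ofReal (mem_ball_zero_iff.1 hy).le

end Averages

section Rellich

variable {N : ℕ} {Ω : Set (Euc N)} {φ : ℕ → Euc N → ℝ} {M : ℝ≥0}

lemma tendsto_eLpNorm_setAverage_ball (hΩ : Bornology.IsBounded Ω)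
    (hφ : ∀ n, IsTest Ω (φ n)) (hM : ∀ n, eLpNorm (φ n) 2 volume ≤ M)
    (hball : ∀ x r, Tendsto (fun n => ∫ y in Metric.ball x r, φ n y) atTop (𝓝 0))
    {r : ℝ} (hr : 0 < r) :
    Tendsto (fun n => eLpNorm (fun x => ⨍ y in Metric.ball x r, φ n y) 2 volume)
      atTop (𝓝 0) := by
  obtain ⟨R, hR⟩ := hΩ.subset_closedBall 0
  set V := volume (Metric.ball (0 : Euc N) r)
  have hsq := tendsto_lintegral_of_dominated_convergence (μ := (volume : Measure (Euc N)))
    (F := fun n x => ‖⨍ y in Metric.ball x r, φ n y‖ₑ ^ 2) (f := fun _ => 0)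
    ((Metric.closedBall (0 : Euc N) (R + r)).indicator fun _ => V⁻¹ * M ^ 2)
    (fun n => (stronglyMeasurable_setAverage_ball volume
      (hφ n).continuous r).measurable.enorm.pow_const 2)
    (fun n => Eventually.of_forall fun x => ?_) ?_ (Eventually.of_forall fun x => ?_)
  · simp only [← sq_eLpNorm_two, lintegral_zero] at hsq
    have hsqrt := hsq.ennrpow_const (1 / 2)
    simpa only [← ENNReal.rpow_two, ← ENNReal.rpow_mul, mul_one_div_cancel (two_ne_zero' ℝ),
      ENNReal.rpow_one, ENNReal.zero_rpow_of_pos one_half_pos] using hsqrt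
  · by_cases hx : x ∈ Metric.closedBall (0 : Euc N) (R + r)
    · rw [indicator_of_mem hx]
      refine (sq_enorm_setAverage_ball_le volume (hφ n).continuous x hr).trans ?_
      gcongr
      exact hM n
    · have hzero : ∫ y in Metric.ball x r, φ n y = 0 := by
        refine setIntegral_eq_zero_of_forall_eq_zero fun y hy => (hφ n).eq_zero fun hyΩ => hx ?_
        exact Metric.mem_closedBall.2 <| (dist_triangle_left x 0 y).trans <|
          (add_comm _ _).trans_le <| add_le_add (hR hyΩ) (Metric.mem_ball.1 hy).le
      simp only [setAverage_eq, hzero, smul_zero, enorm_zero, ne_eq, OfNat.ofNat_ne_zero,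
        not_false_eq_true, zero_pow, zero_le]
  · rw [lintegral_indicator Metric.isClosed_closedBall.measurableSet, setLIntegral_const]
    have hV : V ≠ 0 := (Metric.measure_ball_pos volume (0 : Euc N) hr).ne'
    have hball := (measure_closedBall_lt_top (μ := volume) (x := (0 : Euc N)) (r := R + r)).ne
    finiteness
  · simp only [setAverage_eq, smul_eq_mul, measureReal_def, Measure.addHaar_ball_center]
    simpa using ENNReal.Tendsto.pow (n := 2) ((hball x r).const_mul V.toReal⁻¹).enorm

lemma tendsto_eLpNorm_of_tendsto_setIntegral_ball (hΩ : Bornology.IsBounded Ω)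
    (hφ : ∀ n, IsTest Ω (φ n)) (hM : ∀ n, eLpNorm (φ n) 2 volume ≤ M)
    (hM' : ∀ n, eLpNorm (∇ (φ n)) 2 volume ≤ M)
    (hball : ∀ x r, Tendsto (fun n => ∫ y in Metric.ball x r, φ n y) atTop (𝓝 0)) :
    Tendsto (fun n => eLpNorm (φ n) 2 volume) atTop (𝓝 0) := by
  have hle (r : ℝ) (hr : 0 < r) (n : ℕ) : eLpNorm (φ n) 2 volume ≤
      eLpNorm (fun x => ⨍ y in Metric.ball x r, φ n y) 2 volume + ENNReal.ofReal r * M := by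
    have havg : AEStronglyMeasurable (fun x => ⨍ y in Metric.ball x r, φ n y) volume :=
      (stronglyMeasurable_setAverage_ball volume (hφ n).continuous r).aestronglyMeasurable
    have hcont := (hφ n).continuous.aestronglyMeasurable (μ := volume)
    have hsub := eLpNorm_setAverage_ball_sub_le volume (hφ n).contDiff_one
      (hφ n).hasCompactSupport hr
    rw [← eLpNorm_gradient] at hsub
    have htri := eLpNorm_sub_le havg (havg.sub hcont) one_le_two
    rw [sub_sub_cancel] at htri
    refine htri.trans ?_
    gcongr
    exact hsub.trans (by gcongr; exact hM' n)
  have hradius : Tendsto (fun r : ℝ => ENNReal.ofReal r * M) (𝓝[>] 0) (𝓝 0) := by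
    have hof : Tendsto ENNReal.ofReal (𝓝[>] 0) (𝓝 0) := by
      simpa using (ENNReal.continuous_ofReal.tendsto 0).mono_left nhdsWithin_le_nhds
    simpa using ENNReal.Tendsto.mul_const hof (Or.inr ENNReal.coe_ne_top)
  rw [ENNReal.tendsto_nhds_zero]
  intro δ hδ
  obtain ⟨r, hrδ, hr⟩ := ((ENNReal.tendsto_nhds_zero.1 hradius _ (ENNReal.half_pos hδ.ne')).and
    self_mem_nhdsWithin).exists
  filter_upwards [ENNReal.tendsto_nhds_zero.1 (tendsto_eLpNorm_setAverage_ball hΩ hφ hM hball hr)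
    _ (ENNReal.half_pos hδ.ne')] with n hn
  exact (hle r hr n).trans ((add_le_add hn hrδ).trans_eq (ENNReal.add_halves δ))

lemma IsPair.tendsto_fst (hΩ : Bornology.IsBounded Ω) {v : ℕ → TestClosure N 2 Ω}
    (hv : ∀ n, IsPair Ω (v n).1 (φ n)) (hM : ∀ n, ‖v n‖ ≤ M)
    (hweak : ∀ ℓ : TestClosure N 2 Ω →L[ℝ] ℝ, Tendsto (fun n => ℓ (v n)) atTop (𝓝 0)) :
    Tendsto (fun n => (v n).1.fst) atTop (𝓝 0) := by
  have hlim := tendsto_eLpNorm_of_tendsto_setIntegral_ball hΩ (fun n => (hv n).isTest) (M := M)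
    (fun n => ?_) (fun n => ?_) fun x r => ?_
  · refine tendsto_zero_iff_norm_tendsto_zero.2 ?_
    simpa [Lp.norm_def, eLpNorm_congr_ae (hv _).fst_ae_eq, Function.comp_def] using
      (ENNReal.tendsto_toReal ENNReal.zero_ne_top).comp hlim
  · rw [← eLpNorm_congr_ae (hv n).fst_ae_eq, ← Lp.enorm_def]
    exact enorm_le_coe.2 ((WithLp.nnnorm_fst_le _ _).trans (hM n))
  · rw [← eLpNorm_congr_ae (hv n).snd_ae_eq, ← Lp.enorm_def]
    exact enorm_le_coe.2 ((WithLp.nnnorm_snd_le _ _).trans (hM n))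
  · have hball := hweak ((innerSL ℝ (indicatorConstLp 2 measurableSet_ball
      (measure_ball_lt_top (x := x) (r := r)).ne (1 : ℝ))).comp (fstCLM N 2 Ω))
    refine hball.congr fun n => ?_
    rw [ContinuousLinearMap.comp_apply, innerSL_apply_apply, fstCLM_apply,
      L2.inner_indicatorConstLp_one]
    exact setIntegral_congr_ae measurableSet_ball
      ((hv n).fst_ae_eq.mono fun x hx _ => hx)

/-- Rellich's theorem. -/
theorem tendsto_fst_of_forall_tendsto_apply (hΩ : Bornology.IsBounded Ω)
    {u : ℕ → TestClosure N 2 Ω} {M : ℝ} (hM : ∀ n, ‖u n‖ ≤ M)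
    (hweak : ∀ ℓ : TestClosure N 2 Ω →L[ℝ] ℝ, Tendsto (fun n => ℓ (u n)) atTop (𝓝 0)) :
    Tendsto (fun n => (u n).1.fst) atTop (𝓝 0) := by
  have happrox (n : ℕ) : ∃ (φ : Euc N → ℝ) (v : TestClosure N 2 Ω), IsPair Ω v.1 φ ∧
      ‖v - u n‖ < 1 / ((n : ℝ) + 1) := by
    obtain ⟨φ, v, hv, hlim⟩ := exists_isPair_tendsto (u n)
    obtain ⟨m, hm⟩ := ((tendsto_iff_norm_sub_tendsto_zero.1 hlim).eventually
      (gt_mem_nhds (by positivity : (0 : ℝ) < 1 / ((n : ℝ) + 1)))).exists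
    exact ⟨φ m, v m, hv m, hm⟩
  choose φ v hv hvu using happrox
  have hdiff : Tendsto (fun n => v n - u n) atTop (𝓝 0) :=
    squeeze_zero_norm (fun n => (hvu n).le) tendsto_one_div_add_atTop_nhds_zero_nat
  have hvM (n : ℕ) : ‖v n‖ ≤ (M + 1).toNNReal := by
    have hone : 1 / ((n : ℝ) + 1) ≤ 1 := (div_le_one (by positivity)).2 (by simp)
    have htri := norm_le_norm_add_norm_sub' (v n) (u n)
    exact (by linarith [hM n, hvu n] : ‖v n‖ ≤ M + 1).trans (Real.le_coe_toNNReal _)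
  have hv0 : Tendsto (fun n => (v n).1.fst) atTop (𝓝 0) := by
    refine IsPair.tendsto_fst hΩ hv hvM fun ℓ => ?_
    simpa [Function.comp_def] using ((ℓ.continuous.tendsto 0).comp hdiff).add (hweak ℓ)
  simpa [Function.comp_def] using
    hv0.sub (((fstCLM N 2 Ω).continuous.tendsto 0).comp hdiff)

end Rellich

section FormBounded

variable {N : ℕ} {p q : ℝ≥0∞} {Ω : Set (Euc N)} {f g W W₁ W₂ φ : Euc N → ℝ}

lemma IsGradientWeight.mono {Ω' : Set (Euc N)} (hg : IsGradientWeight Ω' q g) (hΩ : Ω ⊆ Ω') :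
    IsGradientWeight Ω q g := by
  obtain ⟨C, hC⟩ := hg.exists_le
  exact ⟨hg.measurable, C, fun φ hφ => hC φ (hφ.mono hΩ)⟩

lemma IsGradientWeight.of_abs_le (hg : IsGradientWeight Ω q g) (hf : Measurable f) {K : ℝ}
    (hfg : ∀ x, |f x| ≤ K * |g x|) : IsGradientWeight Ω q f := by
  obtain ⟨C, hC⟩ := hg.exists_le
  refine ⟨hf, K.toNNReal * C, fun φ hφ => ?_⟩
  have hle : eLpNorm (fun x => f x * φ x) q volume ≤
      K.toNNReal * eLpNorm (fun x => g x * φ x) q volume := by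
    refine eLpNorm_le_mul_eLpNorm_of_ae_le_mul (Eventually.of_forall fun x => ?_) q
    rw [norm_mul, norm_mul, ← mul_assoc, Real.norm_eq_abs (f x), Real.norm_eq_abs (g x)]
    gcongr
    exact hfg x
  calc eLpNorm (fun x => f x * φ x) q volume
      ≤ K.toNNReal * eLpNorm (fun x => g x * φ x) q volume := hle
    _ ≤ K.toNNReal * (C * eLpNorm (∇ φ) 2 volume) := by gcongr; exact hC φ hφ
    _ = (K.toNNReal * C : ℝ≥0) * eLpNorm (∇ φ) 2 volume := by push_cast; ring

lemma IsGradientWeight.add (hq : 1 ≤ q) (hf : IsGradientWeight Ω q f)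
    (hg : IsGradientWeight Ω q g) : IsGradientWeight Ω q fun x => f x + g x := by
  obtain ⟨C, hC⟩ := hf.exists_le
  obtain ⟨D, hD⟩ := hg.exists_le
  refine ⟨hf.measurable.add hg.measurable, C + D, fun φ hφ => ?_⟩
  have hφm := hφ.continuous.measurable
  simp only [add_mul, ENNReal.coe_add]
  exact (eLpNorm_add_le (hf.measurable.mul hφm).aestronglyMeasurable
    (hg.measurable.mul hφm).aestronglyMeasurable hq).trans (add_le_add (hC φ hφ) (hD φ hφ))

/-- The potential `W` is form bounded with respect to `-Δ` on `C_c^∞(Ω)`, that is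
`∫ |W| φ² ≤ C ∫ |∇φ|²`. -/
structure IsFormBounded (Ω : Set (Euc N)) (W : Euc N → ℝ) : Prop where
  measurable : Measurable W
  isGradientWeight : IsGradientWeight Ω 2 fun x => √|W x|

namespace IsFormBounded

lemma mono {Ω' : Set (Euc N)} (hW : IsFormBounded Ω' W) (hΩ : Ω ⊆ Ω') : IsFormBounded Ω W :=
  ⟨hW.measurable, hW.isGradientWeight.mono hΩ⟩

lemma of_abs_le (hg : IsGradientWeight Ω 2 g) (hW : Measurable W) {K : ℝ}
    (hWg : ∀ x, |W x| ≤ K * g x ^ 2) : IsFormBounded Ω W := by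
  refine ⟨hW, hg.of_abs_le (K := √K) (by fun_prop) fun x => ?_⟩
  rw [abs_of_nonneg (Real.sqrt_nonneg _), ← Real.sqrt_sq_eq_abs (g x),
    ← Real.sqrt_mul' _ (sq_nonneg _)]
  exact Real.sqrt_le_sqrt (hWg x)

protected lemma zero : IsFormBounded Ω fun _ => 0 :=
  ⟨measurable_const, by fun_prop, 0, fun φ _ => by simp⟩

protected lemma add (h₁ : IsFormBounded Ω W₁) (h₂ : IsFormBounded Ω W₂) :
    IsFormBounded Ω fun x => W₁ x + W₂ x := by
  have hm := h₁.measurable.add h₂.measurable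
  refine ⟨hm, (h₁.isGradientWeight.add one_le_two h₂.isGradientWeight).of_abs_le (K := 1)
    hm.abs.sqrt fun x => ?_⟩
  rw [one_mul, abs_of_nonneg (Real.sqrt_nonneg _),
    abs_of_nonneg (add_nonneg (Real.sqrt_nonneg _) (Real.sqrt_nonneg _)), Real.sqrt_le_iff]
  refine ⟨by positivity, (abs_add_le _ _).trans ?_⟩
  nlinarith [Real.sq_sqrt (abs_nonneg (W₁ x)), Real.sq_sqrt (abs_nonneg (W₂ x)),
    mul_nonneg (Real.sqrt_nonneg |W₁ x|) (Real.sqrt_nonneg |W₂ x|)]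

protected lemma sum {ι : Type*} {V : ι → Euc N → ℝ} (s : Finset ι)
    (hV : ∀ i ∈ s, IsFormBounded Ω (V i)) : IsFormBounded Ω fun x => ∑ i ∈ s, V i x := by
  classical
  induction s using Finset.induction_on with
  | empty => simpa using IsFormBounded.zero
  | insert j s hj ih =>
    simp only [Finset.sum_insert hj]
    exact (hV j (s.mem_insert_self j)).add (ih fun i hi => hV i (Finset.mem_insert_of_mem hi))

lemma isGradientWeight_div_sqrt (hW : IsFormBounded Ω W) :
    IsGradientWeight Ω 2 fun x => W x / √|W x| := by
  refine hW.isGradientWeight.of_abs_le (K := 1) (hW.measurable.div hW.isGradientWeight.measurable)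
    fun x => ?_
  rw [abs_div, abs_of_nonneg (Real.sqrt_nonneg |W x|), Real.div_sqrt, one_mul]

variable [Fact (1 ≤ p)]

variable (p) in
/-- The bounded bilinear form `∫ W u v` of a form bounded potential `W`. -/
noncomputable def form (hW : IsFormBounded Ω W) :
    TestClosure N p Ω →L[ℝ] TestClosure N p Ω →L[ℝ] ℝ :=
  (innerSL ℝ).bilinearComp (hW.isGradientWeight_div_sqrt.mulCLM p) (hW.isGradientWeight.mulCLM p)

lemma inner_mulCLM_ae_eq (hW : IsFormBounded Ω W) (w v : TestClosure N p Ω) :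
    (fun x => inner ℝ (hW.isGradientWeight_div_sqrt.mulCLM p w x)
      (hW.isGradientWeight.mulCLM p v x)) =ᵐ[volume] fun x => W x * w.1.fst x * v.1.fst x := by
  filter_upwards [hW.isGradientWeight_div_sqrt.coeFn_mulCLM w, hW.isGradientWeight.coeFn_mulCLM v]
    with x hw hv
  have hWx : W x / √|W x| * √|W x| = W x :=
    div_mul_cancel_of_imp fun h => by simpa [Real.sqrt_eq_zero'] using h
  rw [hw, hv, RCLike.inner_apply, conj_trivial]
  linear_combination w.1.fst x * v.1.fst x * hWx

lemma integrable_mul_fst_mul_fst (hW : IsFormBounded Ω W) (w v : TestClosure N p Ω) :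
    Integrable fun x => W x * w.1.fst x * v.1.fst x :=
  (L2.integrable_inner (𝕜 := ℝ) _ _).congr (hW.inner_mulCLM_ae_eq w v)

lemma form_apply (hW : IsFormBounded Ω W) (w v : TestClosure N p Ω) :
    hW.form p w v = ∫ x, W x * w.1.fst x * v.1.fst x := by
  rw [form, ContinuousLinearMap.bilinearComp_apply, innerSL_apply_apply, L2.inner_def]
  exact integral_congr_ae (hW.inner_mulCLM_ae_eq w v)

lemma form_comm (hW : IsFormBounded Ω W) (w v : TestClosure N p Ω) :
    hW.form p w v = hW.form p v w := by
  simp only [form_apply, mul_right_comm _ (w.1.fst _)]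

lemma form_self (hW : IsFormBounded Ω W) (w : TestClosure N p Ω) :
    hW.form p w w = ∫ x, W x * w.1.fst x ^ 2 := by
  simp only [form_apply, mul_assoc, sq]

lemma integrable_mul_fst_sq (hW : IsFormBounded Ω W) (w : TestClosure N p Ω) :
    Integrable fun x => W x * w.1.fst x ^ 2 := by
  simpa only [mul_assoc, sq] using hW.integrable_mul_fst_mul_fst w w

omit [Fact (1 ≤ p)] in
lemma integrable_mul_sq (hW : IsFormBounded Ω W) (hφ : IsTest Ω φ) :
    Integrable fun x => W x * φ x ^ 2 := by
  obtain ⟨w, hw⟩ := hφ.exists_isPair 2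
  exact (hW.integrable_mul_fst_sq w).congr (hw.fst_ae_eq.mono fun x hx => by simp only [hx])

end IsFormBounded

/-- The quadratic form `∫ (|∇φ|² - W φ²)` of the Schrödinger operator `-Δ - W`. -/
noncomputable def schrodingerForm (W φ : Euc N → ℝ) : ℝ := ∫ x, (‖∇ φ x‖ ^ 2 - W x * φ x ^ 2)

variable [Fact (1 ≤ p)]

variable (p) in
/-- The bounded bilinear form `∫ (⟪∇u, ∇v⟫ - W u v)` of the Schrödinger operator `-Δ - W` with a
form bounded potential `W`. -/
noncomputable def IsFormBounded.schrodingerBilin (hW : IsFormBounded Ω W) :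
    TestClosure N p Ω →L[ℝ] TestClosure N p Ω →L[ℝ] ℝ :=
  ((innerSL ℝ).bilinearComp (sndCLM N p Ω) (sndCLM N p Ω) :
    TestClosure N p Ω →L[ℝ] TestClosure N p Ω →L[ℝ] ℝ) - hW.form p

lemma IsFormBounded.schrodingerBilin_apply (hW : IsFormBounded Ω W) (w v : TestClosure N p Ω) :
    hW.schrodingerBilin p w v = inner ℝ w.1.snd v.1.snd - hW.form p w v :=
  rfl

lemma IsFormBounded.schrodingerBilin_comm (hW : IsFormBounded Ω W) (w v : TestClosure N p Ω) :
    hW.schrodingerBilin p w v = hW.schrodingerBilin p v w := by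
  rw [hW.schrodingerBilin_apply, hW.schrodingerBilin_apply, real_inner_comm, hW.form_comm]

lemma IsFormBounded.schrodingerBilin_self (hW : IsFormBounded Ω W) (w : TestClosure N p Ω) :
    hW.schrodingerBilin p w w = ∫ x, (‖w.1.snd x‖ ^ 2 - W x * w.1.fst x ^ 2) := by
  rw [hW.schrodingerBilin_apply, real_inner_self_eq_norm_sq, hW.form_self, norm_sq_Lp_two,
    ← integral_sub ((Lp.memLp w.1.snd).integrable_norm_pow (by simp)) (hW.integrable_mul_fst_sq w)]

lemma IsPair.integral_eq_schrodingerForm {w : PairSpace N p} (hw : IsPair Ω w φ) :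
    ∫ x, (‖w.snd x‖ ^ 2 - W x * w.fst x ^ 2) = schrodingerForm W φ := by
  refine integral_congr_ae ?_
  filter_upwards [hw.fst_ae_eq, hw.snd_ae_eq] with x h₁ h₂
  rw [h₁, h₂]

lemma IsFormBounded.integral_nonneg_of_forall_isTest (hW : IsFormBounded Ω W)
    (h : ∀ φ, IsTest Ω φ → 0 ≤ schrodingerForm W φ) (w : TestClosure N p Ω) :
    0 ≤ ∫ x, (‖w.1.snd x‖ ^ 2 - W x * w.1.fst x ^ 2) := by
  refine testClosure_induction
    (P := fun w : TestClosure N p Ω => 0 ≤ ∫ x, (‖w.1.snd x‖ ^ 2 - W x * w.1.fst x ^ 2))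
    ?_ (fun w φ hw => ?_) w
  · simp only [← hW.schrodingerBilin_self]
    exact isClosed_le continuous_const
      ((hW.schrodingerBilin p).continuous.clm_apply continuous_id)
  · exact (h φ hw.isTest).trans_eq hw.integral_eq_schrodingerForm.symm

omit [Fact (1 ≤ p)] in
lemma schrodingerForm_le_add (h₁ : IsFormBounded Ω W₁) (h₂ : IsFormBounded Ω W₂)
    (hφ : IsTest Ω φ) {K : ℝ} (hK : ∀ x, φ x ≠ 0 → W₁ x ≤ W₂ x + K) :
    schrodingerForm W₂ φ ≤ schrodingerForm W₁ φ + K * ∫ x, φ x ^ 2 := by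
  have hint₁ : Integrable fun x => ‖∇ φ x‖ ^ 2 - W₁ x * φ x ^ 2 :=
    hφ.integrable_gradient_sq.sub (h₁.integrable_mul_sq hφ)
  have hintK := hφ.integrable_sq.const_mul K
  rw [schrodingerForm, schrodingerForm, ← integral_const_mul, ← integral_add hint₁ hintK]
  refine integral_mono (hφ.integrable_gradient_sq.sub (h₂.integrable_mul_sq hφ))
    (hint₁.add hintK) fun x => ?_
  rcases eq_or_ne (φ x) 0 with hx | hx
  · simp [hx]
  · linarith [mul_le_mul_of_nonneg_right (hK x hx) (sq_nonneg (φ x))]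

end FormBounded

section Poles

variable {N : ℕ} {Ω : Set (Euc N)} {a b : Euc N} {V W φ : Euc N → ℝ} {h : Sph N → ℝ}

/-- A form bounded potential whose only possible singularity is the pole `a`. -/
structure IsPolePotential (a : Euc N) (V : Euc N → ℝ) : Prop where
  isFormBounded : IsFormBounded univ V
  exists_abs_le : ∀ r > 0, ∃ K, ∀ x, r ≤ ‖x - a‖ → |V x| ≤ K

lemma IsPolePotential.isBigO_one (hV : IsPolePotential a V) (hb : b ≠ a) :
    V =O[𝓝 b] fun _ => (1 : ℝ) := by
  obtain ⟨K, hK⟩ := hV.exists_abs_le (‖b - a‖ / 2) (by simpa [sub_eq_zero] using hb)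
  refine Asymptotics.IsBigO.of_bound K ?_
  have hfar : ∀ᶠ x in 𝓝 b, ‖b - a‖ / 2 < ‖x - a‖ :=
    (continuous_id.sub continuous_const).norm.continuousAt.eventually
      (lt_mem_nhds (half_lt_self (norm_pos_iff.2 (sub_ne_zero.2 hb))))
  filter_upwards [hfar] with x hx
  simpa using hK x hx.le

lemma measurable_angularPotential (hh : Measurable h) : Measurable (angularPotential h) := by
  obtain ⟨H, hHm, hH⟩ := (MeasurableEmbedding.subtype_coe
    (Metric.isClosed_sphere (x := (0 : Euc N)) (ε := 1)).measurableSet).exists_measurable_extend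
      hh fun _ => ⟨0⟩
  have heq : angularPotential h = fun x => H (‖x‖⁻¹ • x) / ‖x‖ ^ 2 := by
    ext x
    rw [angularPotential]
    split_ifs with hx
    · simp [hx]
    · rw [← hH, Function.comp_apply]
  rw [heq]
  fun_prop

lemma abs_angularPotential_le {C : ℝ} (hC : ∀ s, |h s| ≤ C) (x : Euc N) :
    |angularPotential h x| ≤ C * ‖x‖⁻¹ ^ 2 := by
  rw [angularPotential]
  split_ifs with hx
  · simp [hx]
  · rw [abs_div, abs_of_nonneg (by positivity : 0 ≤ ‖x‖ ^ 2), div_eq_mul_inv, inv_pow]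
    gcongr
    exact hC _

lemma isPolePotential_angularPotential (hN : 2 < N) (hh : Measurable h)
    (hb : ∃ C, ∀ s, |h s| ≤ C) (a : Euc N) :
    IsPolePotential a fun x => angularPotential h (x - a) := by
  obtain ⟨C, hC⟩ := hb
  refine ⟨.of_abs_le (isGradientWeight_inv_norm_sub hN a)
    ((measurable_angularPotential hh).comp (by fun_prop))
    fun x => abs_angularPotential_le hC (x - a), fun r hr => ⟨|C| * r⁻¹ ^ 2, fun x hx => ?_⟩⟩
  refine (abs_angularPotential_le hC (x - a)).trans ?_
  gcongr
  exact le_abs_self C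

lemma angularPotential_smul {s : ℝ} (hs : 0 < s) (x : Euc N) :
    s ^ 2 * angularPotential h (s • x) = angularPotential h x := by
  rcases eq_or_ne x 0 with rfl | hx
  · simp [angularPotential]
  have hdir : ‖s • x‖⁻¹ • s • x = ‖x‖⁻¹ • x := by
    rw [norm_smul, Real.norm_of_nonneg hs.le, smul_smul]
    congr 1
    field_simp
  have hnorm : ‖s • x‖ ^ 2 = s ^ 2 * ‖x‖ ^ 2 := by
    rw [norm_smul, Real.norm_of_nonneg hs.le, mul_pow]
  simp only [angularPotential, hx, smul_ne_zero hs.ne' hx, dif_neg, not_false_eq_true, hdir, hnorm]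
  field_simp

lemma integral_comp_smul_sub (F : Euc N → ℝ) {s : ℝ} (hs : 0 < s) (a : Euc N) :
    ∫ x, F (s • (x - a)) = (s ^ N)⁻¹ * ∫ x, F x := by
  rw [integral_sub_right_eq_self (fun x => F (s • x)) a,
    Measure.integral_comp_smul_of_nonneg (μ := (volume : Measure (Euc N))) F s (hR := hs.le)]
  simp

lemma schrodingerForm_angularPotential_comp_smul_sub (hφ : Differentiable ℝ φ) {s : ℝ}
    (hs : 0 < s) (a : Euc N) :
    schrodingerForm (fun x => angularPotential h (x - a)) (fun x => φ (s • (x - a))) =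
      s ^ 2 * (s ^ N)⁻¹ * schrodingerForm (angularPotential h) φ := by
  rw [mul_assoc, schrodingerForm, schrodingerForm, ← integral_comp_smul_sub _ hs a,
    ← integral_const_mul]
  refine integral_congr_ae (Eventually.of_forall fun x => ?_)
  simp only
  rw [gradient_comp_smul_sub hφ, norm_smul, mul_pow, Real.norm_of_nonneg hs.le,
    ← angularPotential_smul hs (x - a)]
  ring

/-- Concentrating a test function at `a` makes every part of `W` except the singular part at `a`
negligible. -/
lemma schrodingerForm_angularPotential_nonneg (hΩ : Ω ∈ 𝓝 a) (hW : IsFormBounded Ω W)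
    (hpos : ∀ ψ, IsTest Ω ψ → 0 ≤ schrodingerForm W ψ)
    (hV : IsFormBounded Ω fun x => angularPotential h (x - a))
    (hWV : (fun x => W x - angularPotential h (x - a)) =O[𝓝 a] fun _ => (1 : ℝ))
    (hφ : IsTest univ φ) : 0 ≤ schrodingerForm (angularPotential h) φ := by
  obtain ⟨K, hK⟩ := hWV.bound
  obtain ⟨r, hr, hball⟩ := Metric.eventually_nhds_iff_ball.1 (hK.and hΩ)
  obtain ⟨R, hR⟩ := hφ.exists_comp_smul_sub
  have hlower (s : ℝ) (hs : 0 < s) (hRs : R / s < r) :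
      0 ≤ schrodingerForm (angularPotential h) φ + K * (∫ x, φ x ^ 2) * s⁻¹ ^ 2 := by
    have hsub := Metric.closedBall_subset_ball (x := a) hRs
    have hψ : IsTest Ω fun x => φ (s • (x - a)) :=
      (hR s hs a).mono fun x hx => (hball x (hsub hx)).2
    have hle := (hpos _ hψ).trans <| schrodingerForm_le_add hV hW hψ (K := K) fun x hx => by
      have hxK := (hball x (hsub (not_imp_comm.1 (hR s hs a).eq_zero hx))).1
      rw [norm_one, mul_one, Real.norm_eq_abs] at hxK
      linarith [neg_le_of_abs_le hxK]
    rw [schrodingerForm_angularPotential_comp_smul_sub hφ.differentiable hs,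
      integral_comp_smul_sub (fun x => φ x ^ 2) hs] at hle
    have hfactor : 0 ≤ s ^ 2 * (s ^ N)⁻¹ *
        (schrodingerForm (angularPotential h) φ + K * (∫ x, φ x ^ 2) * s⁻¹ ^ 2) := by
      refine hle.trans_eq ?_
      field_simp
    exact nonneg_of_mul_nonneg_right hfactor (by positivity)
  have hlim : Tendsto (fun s : ℝ =>
      schrodingerForm (angularPotential h) φ + K * (∫ x, φ x ^ 2) * s⁻¹ ^ 2) atTop
      (𝓝 (schrodingerForm (angularPotential h) φ)) := by
    simpa using ((tendsto_inv_atTop_zero.pow 2).const_mul _).const_add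
      (schrodingerForm (angularPotential h) φ)
  refine ge_of_tendsto hlim ?_
  filter_upwards [(tendsto_const_nhds.div_atTop tendsto_id).eventually_lt_const hr,
    eventually_gt_atTop 0] with s hRs hs using hlower s hs hRs

end Poles

section Localization

variable {N : ℕ} {p : ℝ≥0∞} {a : Euc N} {m : ℝ} {V W W₁ W₂ φ θ : Euc N → ℝ}

lemma sq_eLpNorm_le_add {α : Type*} [MeasurableSpace α] {μ : Measure α} {f g φ : α → ℝ}
    (hp : 2 ≤ p) (hf : AEStronglyMeasurable f μ) (hg : AEStronglyMeasurable g μ)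
    (hφ : ∀ x, φ x ^ 2 = f x ^ 2 + g x ^ 2) :
    eLpNorm φ p μ ^ 2 ≤ eLpNorm f p μ ^ 2 + eLpNorm g p μ ^ 2 := by
  have hsq (u : α → ℝ) : eLpNorm u p μ ^ 2 = eLpNorm (fun x => u x ^ 2) (p / 2) μ := by
    have hnorm := eLpNorm_norm_rpow (p := p / 2) (μ := μ) u two_pos
    simp only [Real.norm_eq_abs, Real.rpow_two, sq_abs, ENNReal.rpow_two, ENNReal.ofReal_ofNat,
      ENNReal.div_mul_cancel two_ne_zero ENNReal.ofNat_ne_top] at hnorm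
    exact hnorm.symm
  rw [hsq φ, hsq f, hsq g, funext hφ]
  exact eLpNorm_add_le (hf.pow 2) (hg.pow 2)
    ((ENNReal.le_div_iff_mul_le (by simp) (by simp)).2 (by simpa using hp))

lemma sq_lpNorm_le_add {α : Type*} [MeasurableSpace α] {μ : Measure α} {f g φ : α → ℝ}
    (hp : 2 ≤ p) (hf : MemLp f p μ) (hg : MemLp g p μ) (hφm : AEStronglyMeasurable φ μ)
    (hφ : ∀ x, φ x ^ 2 = f x ^ 2 + g x ^ 2) :
    lpNorm φ p μ ^ 2 ≤ lpNorm f p μ ^ 2 + lpNorm g p μ ^ 2 := by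
  have hf_top := ENNReal.pow_ne_top (n := 2) hf.eLpNorm_ne_top
  have hg_top := ENNReal.pow_ne_top (n := 2) hg.eLpNorm_ne_top
  have hle := ENNReal.toReal_mono (ENNReal.add_ne_top.2 ⟨hf_top, hg_top⟩)
    (sq_eLpNorm_le_add hp hf.1 hg.1 hφ)
  rwa [ENNReal.toReal_add hf_top hg_top, ENNReal.toReal_pow, ENNReal.toReal_pow,
    ENNReal.toReal_pow, toReal_eLpNorm hφm, toReal_eLpNorm hf.1, toReal_eLpNorm hg.1] at hle

/-- The IMS localization formula for the partition of unity `sin² θ + cos² θ = 1`. -/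
lemma norm_gradient_sin_mul_sq_add {x : Euc N} (hθ : DifferentiableAt ℝ θ x)
    (hφ : DifferentiableAt ℝ φ x) :
    ‖∇ (fun x => Real.sin (θ x) * φ x) x‖ ^ 2 + ‖∇ (fun x => Real.cos (θ x) * φ x) x‖ ^ 2 =
      ‖∇ φ x‖ ^ 2 + ‖∇ θ x‖ ^ 2 * φ x ^ 2 := by
  have hsin : ∇ (fun x => Real.sin (θ x)) x = Real.cos (θ x) • ∇ θ x := by
    rw [gradient, hθ.hasFDerivAt.sin.fderiv, gradient, map_smul]
  have hcos : ∇ (fun x => Real.cos (θ x)) x = -Real.sin (θ x) • ∇ θ x := by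
    rw [gradient, hθ.hasFDerivAt.cos.fderiv, gradient, map_smul]
  rw [gradient_mul hθ.sin hφ, gradient_mul hθ.cos hφ, hsin, hcos, norm_add_sq_real,
    norm_add_sq_real]
  simp only [norm_smul, inner_smul_left, inner_smul_right, norm_neg, Real.norm_eq_abs, mul_pow,
    sq_abs, conj_trivial]
  linear_combination (‖∇ φ x‖ ^ 2 + φ x ^ 2 * ‖∇ θ x‖ ^ 2) * Real.sin_sq_add_cos_sq (θ x)

lemma schrodingerForm_sin_mul_add_cos_mul_le (h₁ : IsFormBounded univ W₁)
    (h₂ : IsFormBounded univ W₂) (hθ : ContDiff ℝ ∞ θ) {D : ℝ}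
    (hD : ∀ x, W₁ x * Real.cos (θ x) ^ 2 + W₂ x * Real.sin (θ x) ^ 2 + ‖∇ θ x‖ ^ 2 ≤ D)
    (hφ : IsTest univ φ) :
    schrodingerForm W₁ (fun x => Real.sin (θ x) * φ x) +
        schrodingerForm W₂ (fun x => Real.cos (θ x) * φ x) ≤
      schrodingerForm (fun x => W₁ x + W₂ x) φ + D * ∫ x, φ x ^ 2 := by
  have hsin := hφ.mul_left (Real.contDiff_sin.comp hθ)
  have hcos := hφ.mul_left (Real.contDiff_cos.comp hθ)
  simp only [Function.comp_apply] at hsin hcos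
  have hint₁ : Integrable fun x => ‖∇ (fun y => Real.sin (θ y) * φ y) x‖ ^ 2 -
      W₁ x * (Real.sin (θ x) * φ x) ^ 2 :=
    hsin.integrable_gradient_sq.sub (h₁.integrable_mul_sq hsin)
  have hint₂ : Integrable fun x => ‖∇ (fun y => Real.cos (θ y) * φ y) x‖ ^ 2 -
      W₂ x * (Real.cos (θ x) * φ x) ^ 2 :=
    hcos.integrable_gradient_sq.sub (h₂.integrable_mul_sq hcos)
  have hint : Integrable fun x => ‖∇ φ x‖ ^ 2 - (W₁ x + W₂ x) * φ x ^ 2 :=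
    hφ.integrable_gradient_sq.sub ((h₁.add h₂).integrable_mul_sq hφ)
  have hintD := hφ.integrable_sq.const_mul D
  rw [schrodingerForm, schrodingerForm, schrodingerForm, ← integral_const_mul,
    ← integral_add hint₁ hint₂, ← integral_add hint hintD]
  refine integral_mono (hint₁.add hint₂) (hint.add hintD) fun x => ?_
  have hIMS := norm_gradient_sin_mul_sq_add (hθ.differentiable (by simp) x) (hφ.differentiable x)
  have hDφ := mul_le_mul_of_nonneg_right (hD x) (sq_nonneg (φ x))
  have hunit := Real.sin_sq_add_cos_sq (θ x)
  simp only [mul_pow]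
  linear_combination hIMS + hDφ - (W₁ x + W₂ x) * φ x ^ 2 * hunit

lemma IsTest.integral_mul_sq_le {Ω : Set (Euc N)} (hφ : IsTest Ω φ) {η : Euc N → ℝ}
    (hη : ContDiff ℝ ∞ η) (hη_le : ∀ x, |η x| ≤ 1) :
    ∫ x, (η x * φ x) ^ 2 ≤ ∫ x, φ x ^ 2 := by
  refine integral_mono (hφ.mul_left hη).integrable_sq hφ.integrable_sq fun x => ?_
  simp only [mul_pow, ← sq_abs (η x)]
  exact mul_le_of_le_one_left (sq_nonneg _) (pow_le_one₀ (abs_nonneg _) (hη_le x))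

/-- The form of `-Δ - W` controls `m ‖φ‖_{L^p}²` up to an `L²` term. -/
def HasLpBound (p : ℝ≥0∞) (m : ℝ) (W : Euc N → ℝ) : Prop :=
  ∃ C ≥ 0, ∀ φ, IsTest univ φ →
    m * lpNorm φ p volume ^ 2 - C * ∫ x, φ x ^ 2 ≤ schrodingerForm W φ

lemma HasLpBound.add_of_angle (hp : 2 ≤ p) (hm : 0 ≤ m) (hm₁ : HasLpBound p m W₁)
    (hm₂ : HasLpBound p m W₂) (h₁ : IsFormBounded univ W₁) (h₂ : IsFormBounded univ W₂)
    (hθ : ContDiff ℝ ∞ θ) {D : ℝ}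
    (hD : ∀ x, W₁ x * Real.cos (θ x) ^ 2 + W₂ x * Real.sin (θ x) ^ 2 + ‖∇ θ x‖ ^ 2 ≤ D) :
    HasLpBound p m fun x => W₁ x + W₂ x := by
  obtain ⟨C₁, hC₁, hbound₁⟩ := hm₁
  obtain ⟨C₂, hC₂, hbound₂⟩ := hm₂
  refine ⟨C₁ + C₂ + |D|, by positivity, fun φ hφ => ?_⟩
  have hsin := Real.contDiff_sin.comp hθ
  have hcos := Real.contDiff_cos.comp hθ
  have hmink := sq_lpNorm_le_add hp ((hφ.mul_left hsin).memLp p) ((hφ.mul_left hcos).memLp p)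
    hφ.continuous.aestronglyMeasurable fun x => by
      simp only [Function.comp_apply]
      linear_combination -φ x ^ 2 * Real.sin_sq_add_cos_sq (θ x)
  have hIMS := schrodingerForm_sin_mul_add_cos_mul_le h₁ h₂ hθ
    (fun x => (hD x).trans (le_abs_self D)) hφ
  have hsin_le := hφ.integral_mul_sq_le hsin fun x => Real.abs_sin_le_one _
  have hcos_le := hφ.integral_mul_sq_le hcos fun x => Real.abs_cos_le_one _
  have hlower₁ := hbound₁ _ (hφ.mul_left hsin)
  have hlower₂ := hbound₂ _ (hφ.mul_left hcos)
  simp only [Function.comp_apply] at *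
  linarith [mul_le_mul_of_nonneg_left hmink hm, mul_le_mul_of_nonneg_left hsin_le hC₁,
    mul_le_mul_of_nonneg_left hcos_le hC₂]

lemma exists_angle_localized (a : Euc N) {r : ℝ} (hr : 0 < r) :
    ∃ θ : Euc N → ℝ, ContDiff ℝ ∞ θ ∧ (∃ L, ∀ x, ‖∇ θ x‖ ≤ L) ∧
      (∀ x, ‖x - a‖ < r / 2 → θ x = Real.pi / 2) ∧ ∀ x, r ≤ ‖x - a‖ → θ x = 0 := by
  let χ : ContDiffBump a := ⟨r / 2, r, half_pos hr, half_lt_self hr⟩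
  have hθ : IsTest univ fun x => Real.pi / 2 * χ x :=
    ⟨contDiff_const.mul χ.contDiff, χ.hasCompactSupport.mul_left, subset_univ _⟩
  refine ⟨_, hθ.smooth, hθ.continuous_gradient.bounded_above_of_compact_support
    hθ.hasCompactSupport_gradient, fun x hx => ?_, fun x hx => ?_⟩
  · rw [χ.one_of_mem_closedBall (mem_closedBall_iff_norm.2 hx.le), mul_one]
  · rw [χ.zero_of_le_dist (by rwa [dist_eq_norm]), mul_zero]

lemma HasLpBound.add (hp : 2 ≤ p) (hm : 0 ≤ m) (hmV : HasLpBound p m V)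
    (hmW : HasLpBound p m W) (hV : IsPolePotential a V) (hW : IsFormBounded univ W)
    (hWa : W =O[𝓝 a] fun _ => (1 : ℝ)) : HasLpBound p m fun x => V x + W x := by
  obtain ⟨D₂, hD₂⟩ := hWa.bound
  obtain ⟨r, hr, hball⟩ := Metric.eventually_nhds_iff_ball.1 hD₂
  obtain ⟨D₁, hD₁⟩ := hV.exists_abs_le (r / 2) (half_pos hr)
  obtain ⟨θ, hθ, ⟨L, hL⟩, hnear, hfar⟩ := exists_angle_localized a hr
  refine hmV.add_of_angle hp hm hmW hV.isFormBounded hW hθ (D := |D₁| + |D₂| + L ^ 2) fun x => ?_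
  have hgrad : ‖∇ θ x‖ ^ 2 ≤ L ^ 2 := by gcongr; exact hL x
  have hcos : V x * Real.cos (θ x) ^ 2 ≤ |D₁| := by
    rcases lt_or_ge ‖x - a‖ (r / 2) with hx | hx
    · simp [hnear x hx]
    · exact (mul_le_mul_of_nonneg_right ((le_abs_self _).trans ((hD₁ x hx).trans
        (le_abs_self _))) (sq_nonneg _)).trans
        (mul_le_of_le_one_right (abs_nonneg _) (Real.cos_sq_le_one _))
  have hsin : W x * Real.sin (θ x) ^ 2 ≤ |D₂| := by
    rcases lt_or_ge ‖x - a‖ r with hx | hx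
    · have hWx := hball x (mem_ball_iff_norm.2 hx)
      rw [norm_one, mul_one] at hWx
      exact (mul_le_mul_of_nonneg_right ((Real.le_norm_self _).trans (hWx.trans
        (le_abs_self _))) (sq_nonneg _)).trans
        (mul_le_of_le_one_right (abs_nonneg _) (Real.sin_sq_le_one _))
    · simp [hfar x hx]
  linarith

variable {ι : Type*} {s : Finset ι} {a : ι → Euc N} {V : ι → Euc N → ℝ}

lemma isBigO_one_sum_of_isPolePotential {b : Euc N} (hV : ∀ i ∈ s, IsPolePotential (a i) (V i))
    (hb : ∀ i ∈ s, b ≠ a i) : (fun x => ∑ i ∈ s, V i x) =O[𝓝 b] fun _ => (1 : ℝ) :=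
  Asymptotics.IsBigO.fun_sum fun i hi => (hV i hi).isBigO_one (hb i hi)

lemma hasLpBound_sum (hp : 2 ≤ p) (hm : 0 ≤ m) (ha : InjOn a s)
    (hV : ∀ i ∈ s, IsPolePotential (a i) (V i)) (hm₀ : HasLpBound (N := N) p m fun _ => 0)
    (hmV : ∀ i ∈ s, HasLpBound p m (V i)) : HasLpBound p m fun x => ∑ i ∈ s, V i x := by
  classical
  induction s using Finset.induction_on with
  | empty => simpa using hm₀
  | insert j s hj ih =>
    simp only [Finset.forall_mem_insert, Finset.coe_insert] at hV hmV ha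
    simp only [Finset.sum_insert hj]
    exact hmV.1.add hp hm (ih (ha.mono (subset_insert _ _)) hV.2 hmV.2) hV.1
      (.sum s fun i hi => (hV.2 i hi).isFormBounded)
      (isBigO_one_sum_of_isPolePotential hV.2 fun i hi hij =>
        hj (ha (mem_insert _ _) (mem_insert_of_mem _ hi) hij ▸ hi))

end Localization

section BestConstants

lemma IsPair.norm_fst {N : ℕ} {p : ℝ≥0∞} [Fact (1 ≤ p)] {Ω : Set (Euc N)} {w : PairSpace N p}
    {φ : Euc N → ℝ} (hw : IsPair Ω w φ) : ‖w.fst‖ = lpNorm φ p volume := by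
  rw [Lp.norm_def, eLpNorm_congr_ae hw.fst_ae_eq,
    toReal_eLpNorm hw.isTest.continuous.aestronglyMeasurable]

variable {N k : ℕ} [Fact (3 ≤ N)] {h : Sph N → ℝ} {φ : Euc N → ℝ}

lemma integral_abs_rpow_twoStar_rpow
    (u : Lp ℝ (ENNReal.ofReal (twoStar N)) (volume : Measure (Euc N))) :
    (∫ x, |u x| ^ twoStar N) ^ (2 / twoStar N) = ‖u‖ ^ 2 := by
  have hp : 0 < twoStar N := two_pos.trans (two_lt_twoStar N)
  rw [integral_abs_rpow hp, ← Real.rpow_mul (norm_nonneg u), mul_div_cancel₀ _ hp.ne',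
    Real.rpow_two]

lemma singleS_eq_iInf (h : Sph N → ℝ) :
    singleS h = ⨅ w : {w : D12 N // w ≠ 0},
      (∫ x, (‖w.1.1.snd x‖ ^ 2 - angularPotential h x * w.1.1.fst x ^ 2)) / ‖w.1.1.fst‖ ^ 2 := by
  simp only [singleS, integral_abs_rpow_twoStar_rpow]

lemma sobolevS_eq_singleS_zero (N : ℕ) [Fact (3 ≤ N)] : sobolevS N = singleS (0 : Sph N → ℝ) := by
  simp [sobolevS, singleS, angularPotential]

omit [Fact (3 ≤ N)] in
lemma schrodingerForm_angularPotential_zero_nonneg (φ : Euc N → ℝ) :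
    0 ≤ schrodingerForm (angularPotential (0 : Sph N → ℝ)) φ :=
  integral_nonneg fun x => by simp [angularPotential]

lemma singleS_nonneg (hV : IsFormBounded univ (angularPotential h))
    (hpos : ∀ φ, IsTest univ φ → 0 ≤ schrodingerForm (angularPotential h) φ) :
    0 ≤ singleS h := by
  rw [singleS_eq_iInf]
  exact Real.iInf_nonneg fun w =>
    div_nonneg (hV.integral_nonneg_of_forall_isTest hpos w.1) (sq_nonneg _)

lemma singleS_mul_sq_lpNorm_le (hV : IsFormBounded univ (angularPotential h))
    (hpos : ∀ φ, IsTest univ φ → 0 ≤ schrodingerForm (angularPotential h) φ)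
    (hφ : IsTest univ φ) :
    singleS h * lpNorm φ (ENNReal.ofReal (twoStar N)) volume ^ 2 ≤
      schrodingerForm (angularPotential h) φ := by
  obtain ⟨w, hw⟩ := hφ.exists_isPair (ENNReal.ofReal (twoStar N))
  rw [← hw.norm_fst, ← hw.integral_eq_schrodingerForm]
  have hnonneg := hV.integral_nonneg_of_forall_isTest (p := ENNReal.ofReal (twoStar N)) hpos
  rcases eq_or_ne w.1.fst 0 with hfst | hfst
  · simpa [hfst] using hnonneg w
  have hw₀ : w ≠ 0 := fun hw₀ => hfst (by simp [hw₀])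
  rw [← le_div_iff₀ (by positivity), singleS_eq_iInf]
  refine ciInf_le (f := fun w : {w : D12 N // w ≠ 0} => _) ⟨0, ?_⟩ ⟨w, hw₀⟩
  rintro _ ⟨v, rfl⟩
  exact div_nonneg (hnonneg v.1) (sq_nonneg _)

lemma hasLpBound_angularPotential (hV : IsFormBounded univ (angularPotential h))
    (hpos : ∀ φ, IsTest univ φ → 0 ≤ schrodingerForm (angularPotential h) φ) {m : ℝ}
    (hm : m ≤ singleS h) (a : Euc N) :
    HasLpBound (ENNReal.ofReal (twoStar N)) m fun x => angularPotential h (x - a) := by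
  refine ⟨0, le_rfl, fun φ hφ => ?_⟩
  obtain ⟨R, hR⟩ := hφ.exists_comp_smul_sub
  have hψ : IsTest univ fun x => φ (x + a) := by
    simpa using (hR 1 one_pos (-a)).to_univ
  have hlpNorm : lpNorm (fun x => φ (x + a)) (ENNReal.ofReal (twoStar N)) volume =
      lpNorm φ (ENNReal.ofReal (twoStar N)) volume := by
    rw [← toReal_eLpNorm hψ.continuous.aestronglyMeasurable,
      ← toReal_eLpNorm hφ.continuous.aestronglyMeasurable]
    exact congrArg _ (eLpNorm_comp_measurePreserving hφ.continuous.aestronglyMeasurable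
      (measurePreserving_add_right volume a))
  have hform : schrodingerForm (fun x => angularPotential h (x - a)) φ =
      schrodingerForm (angularPotential h) fun x => φ (x + a) := by
    simpa using schrodingerForm_angularPotential_comp_smul_sub (h := h) hψ.differentiable one_pos a
  rw [zero_mul, sub_zero, hform, ← hlpNorm]
  exact (mul_le_mul_of_nonneg_right hm (sq_nonneg _)).trans (singleS_mul_sq_lpNorm_le hV hpos hψ)

lemma hasLpBound_zero_of_le_sobolevS {m : ℝ} (hm : m ≤ sobolevS N) :
    HasLpBound (N := N) (ENNReal.ofReal (twoStar N)) m fun _ => 0 := by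
  have hzero : angularPotential (0 : Sph N → ℝ) = fun _ => 0 := by
    ext; simp [angularPotential]
  simpa [hzero] using hasLpBound_angularPotential (hzero ▸ IsFormBounded.zero)
    (fun φ _ => schrodingerForm_angularPotential_zero_nonneg φ)
    (hm.trans_eq (sobolevS_eq_singleS_zero N)) 0

lemma minS_le_sobolevS (h : Fin k → Sph N → ℝ) : minS h ≤ sobolevS N :=
  Finset.min'_le _ _ (Finset.mem_insert_self _ _)

lemma minS_le_singleS (h : Fin k → Sph N → ℝ) (i : Fin k) : minS h ≤ singleS (h i) :=
  Finset.min'_le _ _ (Finset.mem_insert_of_mem (Finset.mem_image_of_mem _ (Finset.mem_univ i)))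

lemma sobolevS_nonneg (N : ℕ) [Fact (3 ≤ N)] : 0 ≤ sobolevS N :=
  Real.iInf_nonneg fun _ => by positivity

lemma minS_nonneg {h : Fin k → Sph N → ℝ} (hh : ∀ i, 0 ≤ singleS (h i)) : 0 ≤ minS h := by
  refine Finset.le_min' _ _ _ fun y hy => ?_
  simp only [Finset.mem_insert, Finset.mem_image, Finset.mem_univ, true_and] at hy
  obtain rfl | ⟨i, rfl⟩ := hy
  exacts [sobolevS_nonneg N, hh i]

end BestConstants

section PalaisSmale

variable {α : Type*} [MeasurableSpace α] {μ : Measure α} {p : ℝ} [Fact (1 ≤ ENNReal.ofReal p)]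
  {H : Type*} [NormedAddCommGroup H] [InnerProductSpace ℝ H] {A : H →L[ℝ] H →L[ℝ] ℝ}
  {T : H →L[ℝ] Lp ℝ (ENNReal.ofReal p) μ} {R : H →L[ℝ] Lp ℝ 2 μ} {hp : 1 < p}
  {d m κ Λ c C L : ℝ} {u z : ℕ → H} {v : H}

/-- The abstract form of `J_Ω`: `A` is the quadratic form, `T` the embedding into the critical
Lebesgue space. -/
noncomputable def energy (A : H →L[ℝ] H →L[ℝ] ℝ) (T : H →L[ℝ] Lp ℝ (ENNReal.ofReal p) μ)
    (Λ : ℝ) (w : H) : ℝ :=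
  1 / 2 * A w w - Λ / p * ‖T w‖ ^ p

/-- The Fréchet derivative of `energy A T Λ` for symmetric `A`, see `hasFDerivAt_energy`. -/
noncomputable def energyDeriv (hp : 1 < p) (A : H →L[ℝ] H →L[ℝ] ℝ)
    (T : H →L[ℝ] Lp ℝ (ENNReal.ofReal p) μ) (Λ : ℝ) (w : H) : H →L[ℝ] ℝ :=
  A w - Λ • (powerCLM hp (T w)).comp T

lemma energyDeriv_apply (v w : H) :
    energyDeriv hp A T Λ w v = A w v - Λ * powerCLM hp (T w) (T v) := rfl

lemma energyDeriv_apply_self (w : H) :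
    energyDeriv hp A T Λ w w = A w w - Λ * ‖T w‖ ^ p := by
  rw [energyDeriv_apply, powerCLM_apply_self]

lemma hasFDerivAt_energy (hp : 1 < p) (hA : ∀ v w, A v w = A w v) (w : H) :
    HasFDerivAt (energy A T Λ) (energyDeriv hp A T Λ w) w := by
  have hform : HasFDerivAt (fun w => A w w) (A w + A.flip w) w := by
    refine (A.hasFDerivAt.clm_apply (hasFDerivAt_id w)).congr_fderiv ?_
    ext v
    simp
  have hpower := (hasFDerivAt_norm_rpow_Lp hp (T w)).comp w T.hasFDerivAt
  refine ((hform.const_mul (1 / 2)).sub (hpower.const_mul (Λ / p))).congr_fderiv ?_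
  ext v
  have hp₀ : p ≠ 0 := by linarith
  simp only [one_div, smul_add, ContinuousLinearMap.smul_comp, sub_apply, add_apply, smul_apply,
    smul_eq_mul, ContinuousLinearMap.flip_apply, hA v w, ContinuousLinearMap.comp_apply,
    energyDeriv_apply]
  field_simp
  ring

/-- Palais–Smale sequences of `energy A T Λ` at level `c`. -/
structure IsPalaisSmale (hp : 1 < p) (A : H →L[ℝ] H →L[ℝ] ℝ)
    (T : H →L[ℝ] Lp ℝ (ENNReal.ofReal p) μ) (Λ : ℝ) (u : ℕ → H) (c : ℝ) : Prop where
  tendsto_energy : Tendsto (fun n => energy A T Λ (u n)) atTop (𝓝 c)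
  tendsto_energyDeriv : Tendsto (fun n => energyDeriv hp A T Λ (u n)) atTop (𝓝 0)

lemma IsPalaisSmale.comp (hu : IsPalaisSmale hp A T Λ u c) {σ : ℕ → ℕ} (hσ : StrictMono σ) :
    IsPalaisSmale hp A T Λ (u ∘ σ) c :=
  ⟨hu.tendsto_energy.comp hσ.tendsto_atTop, hu.tendsto_energyDeriv.comp hσ.tendsto_atTop⟩

lemma tendsto_apply_of_norm_le {E : Type*} [SeminormedAddCommGroup E] [NormedSpace ℝ E]
    {G : ℕ → E →L[ℝ] ℝ} (hG : Tendsto G atTop (𝓝 0)) {z : ℕ → E} {M : ℝ}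
    (hz : ∀ n, ‖z n‖ ≤ M) : Tendsto (fun n => G n (z n)) atTop (𝓝 0) := by
  refine squeeze_zero_norm (fun n => (G n).le_opNorm_of_le (hz n)) ?_
  simpa using hG.norm.mul_const M

lemma tendsto_zero_of_coercive (hκ : 0 < κ) (hA : ∀ w, κ * ‖w‖ ^ 2 ≤ A w w)
    (h : Tendsto (fun n => A (z n) (z n)) atTop (𝓝 0)) : Tendsto z atTop (𝓝 0) := by
  have hsq : Tendsto (fun n => ‖z n‖ ^ 2) atTop (𝓝 0) := by
    refine squeeze_zero (fun n => sq_nonneg _) (fun n => ?_) (by simpa using h.const_mul κ⁻¹)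
    rw [← div_eq_inv_mul, le_div_iff₀' hκ]
    exact hA _
  simpa using tendsto_zero_iff_norm_tendsto_zero.2 (by simpa using hsq.sqrt)

lemma exists_forall_le_of_mul_sq_le {η : ℝ} (hη : 0 < η) (K₁ K₂ : ℝ) :
    ∃ M, ∀ x : ℝ, η * x ^ 2 ≤ K₁ + K₂ * x → x ≤ M := by
  refine ⟨1 + (|K₁| + |K₂|) / η, fun x hx => ?_⟩
  by_contra! hlt
  have hx₁ : 1 ≤ x := (le_add_of_nonneg_right (by positivity)).trans hlt.le
  have hηx : |K₁| + |K₂| < η * x := by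
    rw [← div_lt_iff₀' hη]
    linarith
  nlinarith [le_abs_self K₁, le_abs_self K₂, abs_nonneg K₁]

/-- Subtracting `p⁻¹ J'(u) u` from `J(u)` cancels the nonlinearity. -/
lemma IsPalaisSmale.exists_norm_le (hu : IsPalaisSmale hp A T Λ u c) (hd : 0 < d)
    (hpd : p⁻¹ = 2⁻¹ - d⁻¹) (hκ : 0 < κ) (hA : ∀ w, κ * ‖w‖ ^ 2 ≤ A w w) :
    ∃ M, ∀ n, ‖u n‖ ≤ M := by
  obtain ⟨K₁, hK₁⟩ := hu.tendsto_energy.bddAbove_range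
  obtain ⟨K₂, hK₂⟩ := hu.tendsto_energyDeriv.norm.bddAbove_range
  obtain ⟨M, hM⟩ := exists_forall_le_of_mul_sq_le (η := d⁻¹ * κ) (by positivity) K₁ (p⁻¹ * K₂)
  refine ⟨M, fun n => hM _ ?_⟩
  have hderiv : -(energyDeriv hp A T Λ (u n) (u n)) ≤ K₂ * ‖u n‖ :=
    (neg_le_abs _).trans (ContinuousLinearMap.le_of_opNorm_le _ (hK₂ (mem_range_self n)) _)
  calc d⁻¹ * κ * ‖u n‖ ^ 2 ≤ d⁻¹ * A (u n) (u n) := by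
        rw [mul_assoc]
        gcongr
        exact hA _
    _ = energy A T Λ (u n) + p⁻¹ * -(energyDeriv hp A T Λ (u n) (u n)) := by
        rw [energyDeriv_apply_self, energy, div_eq_mul_inv Λ]
        linear_combination A (u n) (u n) * hpd
    _ ≤ K₁ + p⁻¹ * (K₂ * ‖u n‖) := by
        gcongr
        exact hK₁ (mem_range_self n)
    _ = K₁ + p⁻¹ * K₂ * ‖u n‖ := by ring

/-- Subtracting `½ J'(u) u` from `J(u)` cancels the quadratic form. -/
lemma IsPalaisSmale.tendsto_mul_norm_rpow (hu : IsPalaisSmale hp A T Λ u c) (hd : 0 < d)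
    (hpd : p⁻¹ = 2⁻¹ - d⁻¹) {M : ℝ} (hM : ∀ n, ‖u n‖ ≤ M) :
    Tendsto (fun n => Λ * ‖T (u n)‖ ^ p) atTop (𝓝 (d * c)) := by
  have hlim := (hu.tendsto_energy.sub
    ((tendsto_apply_of_norm_le hu.tendsto_energyDeriv hM).const_mul (1 / 2))).const_mul d
  simp only [mul_zero, sub_zero] at hlim
  refine hlim.congr fun n => ?_
  rw [energyDeriv_apply_self, energy, div_eq_mul_inv Λ, hpd]
  field_simp
  ring

lemma exists_subseq_weak_and_ae [CompleteSpace H] [TopologicalSpace.SeparableSpace H]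
    (hTR : ∀ w, T w =ᵐ[μ] R w)
    (hR : ∀ (z : ℕ → H) (M : ℝ), (∀ n, ‖z n‖ ≤ M) →
      (∀ ℓ : H →L[ℝ] ℝ, Tendsto (fun n => ℓ (z n)) atTop (𝓝 0)) →
      Tendsto (fun n => R (z n)) atTop (𝓝 0))
    {M : ℝ} (hM : ∀ n, ‖u n‖ ≤ M) :
    ∃ σ : ℕ → ℕ, StrictMono σ ∧ ∃ v : H,
      (∀ ℓ : H →L[ℝ] ℝ, Tendsto (fun n => ℓ (u (σ n) - v)) atTop (𝓝 0)) ∧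
      Tendsto (fun n => R (u (σ n) - v)) atTop (𝓝 0) ∧
      ∀ᵐ x ∂μ, Tendsto (fun n => T (u (σ n) - v) x) atTop (𝓝 0) := by
  obtain ⟨σ, hσ, v, hv⟩ := exists_subseq_forall_tendsto_apply hM
  have hweak : ∀ ℓ : H →L[ℝ] ℝ, Tendsto (fun n => ℓ (u (σ n) - v)) atTop (𝓝 0) := fun ℓ => by
    simpa using (hv ℓ).sub_const (ℓ v)
  have hRz := hR (fun n => u (σ n) - v) (M + ‖v‖)
    (fun n => (norm_sub_le _ _).trans (by gcongr; exact hM _)) hweak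
  obtain ⟨τ, hτ, hae⟩ := (tendstoInMeasure_of_tendsto_Lp hRz).exists_seq_tendsto_ae
  refine ⟨σ ∘ τ, hσ.comp hτ, v, fun ℓ => (hweak ℓ).comp hτ.tendsto_atTop,
    hRz.comp hτ.tendsto_atTop, ?_⟩
  filter_upwards [hae, ae_all_iff.2 fun n => hTR (u (σ (τ n)) - v), Lp.coeFn_zero ℝ 2 μ]
    with x hx hTx hzero
  simp only [Function.comp_apply, hTx]
  rwa [hzero] at hx

lemma IsPalaisSmale.tendsto_of_weak_limit (hu : IsPalaisSmale hp A T Λ u c) (hd : 0 < d)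
    (hpd : p⁻¹ = 2⁻¹ - d⁻¹) {M : ℝ} (hM : ∀ n, ‖u n‖ ≤ M)
    (hv : ∀ ℓ : H →L[ℝ] ℝ, Tendsto (fun n => ℓ (u n - v)) atTop (𝓝 0))
    (hae : ∀ᵐ x ∂μ, Tendsto (fun n => T (u n - v) x) atTop (𝓝 0)) :
    Tendsto (fun n => Λ * ‖T (u n - v)‖ ^ p) atTop (𝓝 (d * c - Λ * ‖T v‖ ^ p)) ∧
      Tendsto (fun n => A (u n - v) (u n - v)) atTop (𝓝 (d * c - Λ * ‖T v‖ ^ p)) := by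
  have hz : ∀ n, ‖u n - v‖ ≤ M + ‖v‖ := fun n =>
    (norm_sub_le _ _).trans (by gcongr; exact hM n)
  have hTz : ∀ n, ‖T (u n - v)‖ ≤ ‖T‖ * (M + ‖v‖) := fun n => T.le_opNorm_of_le (hz n)
  have hTu : ∀ n, T (u n - v) + T v = T (u n) := fun n => by rw [← map_add, sub_add_cancel]
  have hnorm : Tendsto (fun n => Λ * ‖T (u n - v)‖ ^ p) atTop (𝓝 (d * c - Λ * ‖T v‖ ^ p)) := by
    refine ((hu.tendsto_mul_norm_rpow hd hpd hM).sub
      ((brezis_lieb (by linarith) hTz hae (T v)).const_mul Λ)).congr fun n => ?_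
    rw [hTu]
    ring
  refine ⟨hnorm, ?_⟩
  have hsum := ((tendsto_apply_of_norm_le hu.tendsto_energyDeriv hz).sub (hv (A v))).add
    (((brezis_lieb_powerCLM hp hTz hae (T v)).const_mul Λ).add hnorm)
  simp only [mul_zero, sub_zero, zero_add] at hsum
  refine hsum.congr fun n => ?_
  rw [hTu, energyDeriv_apply, map_sub A, sub_apply]
  ring

omit [Fact (1 ≤ ENNReal.ofReal p)] in
lemma eq_zero_of_lt_threshold {I : ℝ} (hd : 0 < d) (hpd : p⁻¹ = 2⁻¹ - d⁻¹) (hm : 0 ≤ m)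
    (hΛ : 0 < Λ) (hI : 0 ≤ I) (hmI : m * I ^ (2 / p) ≤ Λ * I) (hIc : Λ * I ≤ d * c)
    (hc : c < 1 / d * Λ ^ (1 - d / 2) * m ^ (d / 2)) : I = 0 := by
  by_contra hI₀
  have hIpos : 0 < I := hI.lt_of_ne' hI₀
  have hsplit : I ^ (2 / d) * I ^ (2 / p) = I := by
    rw [← Real.rpow_add hIpos, div_eq_mul_inv 2 p, hpd]
    ring_nf
    exact Real.rpow_one I
  have hmle : m ≤ Λ * I ^ (2 / d) := by
    refine le_of_mul_le_mul_right ?_ (Real.rpow_pos_of_pos hIpos (2 / p))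
    rwa [mul_assoc, hsplit]
  refine lt_irrefl (d * c) ?_
  calc d * c < d * (1 / d * Λ ^ (1 - d / 2) * m ^ (d / 2)) := by gcongr
    _ = Λ ^ (1 - d / 2) * m ^ (d / 2) := by field_simp
    _ ≤ Λ ^ (1 - d / 2) * (Λ * I ^ (2 / d)) ^ (d / 2) := by gcongr
    _ = Λ * I := by
      rw [Real.mul_rpow hΛ.le (by positivity), ← Real.rpow_mul hI, ← mul_assoc,
        ← Real.rpow_add hΛ, div_mul_div_cancel₀ hd.ne', sub_add_cancel]
      simp
    _ ≤ d * c := hIc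

lemma eq_zero_of_tendsto_of_lt_threshold (hd : 0 < d) (hpd : p⁻¹ = 2⁻¹ - d⁻¹) (hm : 0 ≤ m)
    (hΛ : 0 < Λ) (hcrit : ∀ w, m * ‖T w‖ ^ 2 - C * ‖R w‖ ^ 2 ≤ A w w)
    (hTz : Tendsto (fun n => Λ * ‖T (z n)‖ ^ p) atTop (𝓝 L))
    (hAz : Tendsto (fun n => A (z n) (z n)) atTop (𝓝 L))
    (hRz : Tendsto (fun n => R (z n)) atTop (𝓝 0)) (hL : L ≤ d * c)
    (hc : c < 1 / d * Λ ^ (1 - d / 2) * m ^ (d / 2)) : L = 0 := by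
  have hp₀ : 0 < p := one_pos.trans_le (ENNReal.one_le_ofReal.1 Fact.out)
  have hI : Tendsto (fun n => ‖T (z n)‖ ^ p) atTop (𝓝 (L / Λ)) :=
    (hTz.div_const Λ).congr fun n => mul_div_cancel_left₀ _ hΛ.ne'
  have hsq : Tendsto (fun n => ‖T (z n)‖ ^ 2) atTop (𝓝 ((L / Λ) ^ (2 / p))) := by
    refine (hI.rpow_const (Or.inr (by positivity))).congr fun n => ?_
    rw [← Real.rpow_mul (norm_nonneg _), mul_div_cancel₀ _ hp₀.ne', Real.rpow_two]
  have hlower := (hsq.const_mul m).sub ((hRz.norm.pow 2).const_mul C)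
  have hmI : m * (L / Λ) ^ (2 / p) ≤ L := by
    simpa using le_of_tendsto_of_tendsto' hlower hAz fun n => hcrit (z n)
  have hΛI : Λ * (L / Λ) = L := mul_div_cancel₀ L hΛ.ne'
  rw [← hΛI, eq_zero_of_lt_threshold hd hpd hm hΛ (ge_of_tendsto' hI fun n => by positivity)
    (hmI.trans_eq hΛI.symm) (hΛI.trans_le hL) hc, mul_zero]

theorem IsPalaisSmale.exists_subseq_tendsto [CompleteSpace H] [TopologicalSpace.SeparableSpace H]
    (hu : IsPalaisSmale hp A T Λ u c) (hd : 0 < d) (hpd : p⁻¹ = 2⁻¹ - d⁻¹) (hm : 0 ≤ m)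
    (hκ : 0 < κ) (hA : ∀ w, κ * ‖w‖ ^ 2 ≤ A w w) (hTR : ∀ w, T w =ᵐ[μ] R w)
    (hcrit : ∀ w, m * ‖T w‖ ^ 2 - C * ‖R w‖ ^ 2 ≤ A w w)
    (hR : ∀ (z : ℕ → H) (M : ℝ), (∀ n, ‖z n‖ ≤ M) →
      (∀ ℓ : H →L[ℝ] ℝ, Tendsto (fun n => ℓ (z n)) atTop (𝓝 0)) →
      Tendsto (fun n => R (z n)) atTop (𝓝 0))
    (hc : 0 < Λ → c < 1 / d * Λ ^ (1 - d / 2) * m ^ (d / 2)) :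
    ∃ σ : ℕ → ℕ, StrictMono σ ∧ ∃ v : H, Tendsto (fun n => u (σ n)) atTop (𝓝 v) := by
  obtain ⟨M, hM⟩ := hu.exists_norm_le hd hpd hκ hA
  obtain ⟨σ, hσ, v, hv, hRz, hae⟩ := exists_subseq_weak_and_ae hTR hR hM
  obtain ⟨hTz, hAz⟩ := (hu.comp hσ).tendsto_of_weak_limit hd hpd (fun n => hM (σ n)) hv hae
  have hL : d * c - Λ * ‖T v‖ ^ p = 0 := by
    rcases le_or_gt Λ 0 with hΛ | hΛ
    · exact le_antisymm
        (le_of_tendsto' hTz fun n => mul_nonpos_of_nonpos_of_nonneg hΛ (by positivity))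
        (ge_of_tendsto' hAz fun n => (by positivity : 0 ≤ κ * _).trans (hA _))
    · exact eq_zero_of_tendsto_of_lt_threshold hd hpd hm hΛ hcrit hTz hAz hRz
        (sub_le_self _ (by positivity)) (hc hΛ)
  rw [hL] at hAz
  exact ⟨σ, hσ, v, tendsto_sub_nhds_zero_iff.1 (tendsto_zero_of_coercive hκ hA hAz)⟩

end PalaisSmale

section MultiPotential

variable {N k : ℕ} {Ω : Set (Euc N)} {a : Fin k → Euc N} {h : Fin k → Sph N → ℝ}

/-- The potential `∑ i, h_i((x - a_i) / |x - a_i|) / |x - a_i|²` of the form `Q_Ω`. -/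
noncomputable def multiPotential (a : Fin k → Euc N) (h : Fin k → Sph N → ℝ) (x : Euc N) : ℝ :=
  ∑ i, angularPotential (h i) (x - a i)

lemma isFormBounded_multiPotential
    (hV : ∀ i, IsPolePotential (a i) fun x => angularPotential (h i) (x - a i)) :
    IsFormBounded Ω (multiPotential a h) :=
  .sum Finset.univ fun i _ => (hV i).isFormBounded.mono (subset_univ Ω)

lemma schrodingerBilin_multiPotential_self
    (hV : ∀ i, IsPolePotential (a i) fun x => angularPotential (h i) (x - a i)) (w : H10 N Ω) :
    (isFormBounded_multiPotential hV).schrodingerBilin 2 w w = formQ Ω a h w := by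
  have hint (i : Fin k) : Integrable fun x => angularPotential (h i) (x - a i) * w.1.fst x ^ 2 :=
    ((hV i).isFormBounded.mono (subset_univ Ω)).integrable_mul_fst_sq w
  rw [IsFormBounded.schrodingerBilin_apply, IsFormBounded.form_self, real_inner_self_eq_norm_sq,
    formQ, setIntegral_norm_snd_sq, ← integral_finsetSum _ fun i _ => hint i]
  simp only [multiPotential, Finset.sum_mul]

lemma formQ_eq_schrodingerForm
    (hV : ∀ i, IsPolePotential (a i) fun x => angularPotential (h i) (x - a i)) {w : H10 N Ω}
    {φ : Euc N → ℝ} (hw : IsPair Ω w.1 φ) :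
    formQ Ω a h w = schrodingerForm (multiPotential a h) φ := by
  rw [← schrodingerBilin_multiPotential_self hV, IsFormBounded.schrodingerBilin_self,
    hw.integral_eq_schrodingerForm]

lemma FormPosDef.schrodingerForm_multiPotential_nonneg (hQ : FormPosDef Ω a h)
    (hV : ∀ i, IsPolePotential (a i) fun x => angularPotential (h i) (x - a i))
    {φ : Euc N → ℝ} (hφ : IsTest Ω φ) : 0 ≤ schrodingerForm (multiPotential a h) φ := by
  obtain ⟨c, hc, hcQ⟩ := hQ
  obtain ⟨w, hw⟩ := hφ.exists_isPair 2
  rw [← formQ_eq_schrodingerForm hV hw]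
  exact (by positivity : 0 ≤ c * ∫ x in Ω, ‖w.1.snd x‖ ^ 2).trans (hcQ w)

lemma FormPosDef.schrodingerForm_angularPotential_nonneg (hQ : FormPosDef Ω a h)
    (hV : ∀ i, IsPolePotential (a i) fun x => angularPotential (h i) (x - a i))
    (ha : Function.Injective a) {i : Fin k} (hΩ : Ω ∈ 𝓝 (a i)) {φ : Euc N → ℝ}
    (hφ : IsTest univ φ) : 0 ≤ schrodingerForm (angularPotential (h i)) φ := by
  refine MultiHardy.schrodingerForm_angularPotential_nonneg hΩ (isFormBounded_multiPotential hV)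
    (fun ψ hψ => hQ.schrodingerForm_multiPotential_nonneg hV hψ)
    ((hV i).isFormBounded.mono (subset_univ Ω)) ?_ hφ
  have hrest := isBigO_one_sum_of_isPolePotential (s := Finset.univ.erase i) (b := a i)
    (fun j _ => hV j) fun j hj => ha.ne (Finset.ne_of_mem_erase hj).symm
  refine hrest.congr_left fun x => ?_
  rw [multiPotential, ← Finset.add_sum_erase _ _ (Finset.mem_univ i), add_sub_cancel_left]

end MultiPotential

section DirichletSpace

variable {N k : ℕ} {Ω : Set (Euc N)} {a : Fin k → Euc N} {h : Fin k → Sph N → ℝ}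

instance secondCountableTopology_pairSpace (N : ℕ) :
    SecondCountableTopology (PairSpace N 2) := by
  have : Fact ((2 : ℝ≥0∞) ≠ ⊤) := ⟨by simp⟩
  have : SecondCountableTopology (Lp ℝ 2 (volume : Measure (Euc N))) := inferInstance
  have : SecondCountableTopology (Lp (Euc N) 2 (volume : Measure (Euc N))) := inferInstance
  exact (WithLp.prodContinuousLinearEquiv 2 ℝ (Lp ℝ 2 (volume : Measure (Euc N)))
    (Lp (Euc N) 2 (volume : Measure (Euc N)))).toHomeomorph.isEmbedding.secondCountableTopology

lemma FormPosDef.exists_mul_sq_norm_le (hQ : FormPosDef Ω a h) (hN : 2 < N)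
    (hΩ : Bornology.IsBounded Ω) : ∃ κ > 0, ∀ w : H10 N Ω, κ * ‖w‖ ^ 2 ≤ formQ Ω a h w := by
  obtain ⟨c, hc, hcQ⟩ := hQ
  have hone := isGradientWeight_one_of_isBounded hN hΩ
  obtain ⟨K, hK⟩ := hone.exists_norm_mulCLM_le (p := 2)
  refine ⟨c / (K ^ 2 + 1), by positivity, fun w => le_trans ?_ (hcQ w)⟩
  have hfst : hone.mulCLM 2 w = w.1.fst :=
    Lp.ext ((hone.coeFn_mulCLM w).trans (.of_forall fun _ => one_mul _))
  have hpoincare : ‖w.1.fst‖ ^ 2 ≤ K ^ 2 * ‖w.1.snd‖ ^ 2 := by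
    rw [← mul_pow, ← hfst]
    gcongr
    exact hK w
  rw [setIntegral_norm_snd_sq, div_mul_eq_mul_div, div_le_iff₀ (by positivity),
    Submodule.coe_norm, WithLp.prod_norm_sq_eq_of_L2, mul_assoc]
  gcongr
  linarith

variable [Fact (3 ≤ N)]

variable (N Ω) in
/-- The Sobolev embedding of `H^1_0(Ω)` into `L^{2^*}(ℝ^N)`. -/
noncomputable def sobolevEmbedding :
    H10 N Ω →L[ℝ] Lp ℝ (ENNReal.ofReal (twoStar N)) (volume : Measure (Euc N)) :=
  (isGradientWeight_one N Ω).mulCLM 2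

lemma coeFn_sobolevEmbedding (w : H10 N Ω) : sobolevEmbedding N Ω w =ᵐ[volume] w.1.fst :=
  ((isGradientWeight_one N Ω).coeFn_mulCLM w).trans (.of_forall fun _ => one_mul _)

lemma setIntegral_abs_fst_rpow (w : H10 N Ω) :
    ∫ x in Ω, |w.1.fst x| ^ twoStar N = ∫ x, |sobolevEmbedding N Ω w x| ^ twoStar N := by
  rw [setIntegral_eq_integral_of_ae_compl_eq_zero]
  · refine integral_congr_ae ?_
    filter_upwards [coeFn_sobolevEmbedding w] with x hx
    rw [hx]
  · filter_upwards [fst_eq_zero_of_notMem w] with x hx hxΩ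
    rw [hx hxΩ, abs_zero, Real.zero_rpow (by linarith [two_lt_twoStar N])]

lemma sobolevEmbedding_toLp_mem_D12 (w : H10 N Ω) :
    WithLp.toLp 2 (sobolevEmbedding N Ω w, w.1.snd) ∈ D12 N := by
  refine testClosure_induction
    (P := fun w : H10 N Ω => WithLp.toLp 2 (sobolevEmbedding N Ω w, w.1.snd) ∈ D12 N)
    ?_ (fun w φ hw => ?_) w
  · exact (testPairs N _ univ).isClosed_topologicalClosure.preimage
      ((WithLp.prod_continuous_toLp 2 _ _).comp
        ((sobolevEmbedding N Ω).continuous.prodMk (sndCLM N 2 Ω).continuous))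
  · exact IsPair.mem_testClosure
      ⟨hw.isTest.to_univ, (coeFn_sobolevEmbedding w).trans hw.fst_ae_eq, hw.snd_ae_eq⟩

variable (N Ω) in
/-- The inclusion of `H^1_0(Ω)` in `D^{1,2}(ℝ^N)`. -/
noncomputable def extendToD12 (w : H10 N Ω) : D12 N :=
  ⟨WithLp.toLp 2 (sobolevEmbedding N Ω w, w.1.snd), sobolevEmbedding_toLp_mem_D12 w⟩

lemma extendToD12_ne_zero {w : H10 N Ω} (hw : w ≠ 0) : extendToD12 N Ω w ≠ 0 := by
  intro hext
  have hT : sobolevEmbedding N Ω w = 0 := congrArg (fun v : D12 N => v.1.fst) hext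
  have hsnd : w.1.snd = 0 := congrArg (fun v : D12 N => v.1.snd) hext
  have hfst : w.1.fst = 0 := by
    refine (Lp.eq_zero_iff_ae_eq_zero).2 ((coeFn_sobolevEmbedding w).symm.trans ?_)
    rw [hT]
    exact Lp.coeFn_zero _ _ _
  exact hw (Subtype.ext (WithLp.ofLp_injective 2 (Prod.ext hfst hsnd)))

lemma wholeQuotient_extendToD12 (w : H10 N Ω) :
    wholeQuotient a h (extendToD12 N Ω w) =
      formQ Ω a h w / (∫ x in Ω, |w.1.fst x| ^ twoStar N) ^ (2 / twoStar N) := by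
  have hfst : (extendToD12 N Ω w).1.fst =ᵐ[volume] w.1.fst := coeFn_sobolevEmbedding w
  rw [wholeQuotient, formQ, setIntegral_abs_fst_rpow, setIntegral_norm_snd_sq, norm_sq_Lp_two]
  congr 2
  refine Finset.sum_congr rfl fun i _ => integral_congr_ae ?_
  filter_upwards [hfst] with x hx
  rw [hx]

omit [Fact (3 ≤ N)] in
lemma nonempty_H10_ne_zero (hΩ : IsOpen Ω) (hne : Ω.Nonempty) :
    Nonempty {w : H10 N Ω // w ≠ 0} := by
  obtain ⟨φ, hφ, hφ₀⟩ := exists_isTest_ne_zero hΩ hne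
  obtain ⟨w, hw⟩ := hφ.exists_isPair 2
  refine ⟨w, fun hw₀ => hφ₀ ((hφ.continuous.ae_eq_iff_eq volume continuous_const).1 ?_)⟩
  refine hw.fst_ae_eq.symm.trans ?_
  rw [hw₀]
  exact Lp.coeFn_zero _ _ _

lemma wholeS_le_domainS (hΩ : IsOpen Ω) (hne : Ω.Nonempty)
    (hb : BddBelow (range fun w : {w : D12 N // w ≠ 0} => wholeQuotient a h w.1)) :
    wholeS a h ≤ domainS Ω a h := by
  have := nonempty_H10_ne_zero hΩ hne
  exact le_ciInf fun w => (ciInf_le hb ⟨_, extendToD12_ne_zero w.2⟩).trans_eq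
    (wholeQuotient_extendToD12 w.1)

lemma energyJ_eq_energy
    (hV : ∀ i, IsPolePotential (a i) fun x => angularPotential (h i) (x - a i)) (Λ : ℝ) :
    energyJ Ω a h Λ =
      energy ((isFormBounded_multiPotential hV).schrodingerBilin 2) (sobolevEmbedding N Ω) Λ := by
  ext w
  rw [energyJ, energy, schrodingerBilin_multiPotential_self hV, setIntegral_abs_fst_rpow,
    integral_abs_rpow (two_pos.trans (two_lt_twoStar N))]

lemma IsPalaisSmale.of_energyJ
    (hV : ∀ i, IsPolePotential (a i) fun x => angularPotential (h i) (x - a i))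
    {Λ c : ℝ} {u : ℕ → H10 N Ω} (hJ : Tendsto (fun n => energyJ Ω a h Λ (u n)) atTop (𝓝 c))
    (hJ' : Tendsto (fun n => fderiv ℝ (energyJ Ω a h Λ) (u n)) atTop (𝓝 0)) :
    IsPalaisSmale (one_lt_two.trans (two_lt_twoStar N))
      ((isFormBounded_multiPotential hV).schrodingerBilin 2) (sobolevEmbedding N Ω) Λ u c := by
  rw [energyJ_eq_energy hV] at hJ hJ'
  have hderiv (w : H10 N Ω) := hasFDerivAt_energy (T := sobolevEmbedding N Ω) (Λ := Λ)
    (one_lt_two.trans (two_lt_twoStar N))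
    (isFormBounded_multiPotential hV).schrodingerBilin_comm w
  exact ⟨hJ, hJ'.congr fun n => (hderiv (u n)).fderiv⟩

lemma HasLpBound.exists_le_schrodingerBilin {W : Euc N → ℝ} {m : ℝ}
    (hm : HasLpBound (ENNReal.ofReal (twoStar N)) m W) (hW : IsFormBounded Ω W) :
    ∃ C, ∀ w : H10 N Ω, m * ‖sobolevEmbedding N Ω w‖ ^ 2 - C * ‖w.1.fst‖ ^ 2 ≤
      hW.schrodingerBilin 2 w w := by
  obtain ⟨C, -, hC⟩ := hm
  refine ⟨C, testClosure_induction (isClosed_le ?_ ?_) fun w φ hw => ?_⟩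
  · exact ((sobolevEmbedding N Ω).continuous.norm.pow 2 |>.const_mul m).sub
      ((fstCLM N 2 Ω).continuous.norm.pow 2 |>.const_mul C)
  · exact (hW.schrodingerBilin 2).continuous.clm_apply continuous_id
  · have hT : ‖sobolevEmbedding N Ω w‖ = lpNorm φ (ENNReal.ofReal (twoStar N)) volume :=
      IsPair.norm_fst (w := (extendToD12 N Ω w).1)
        ⟨hw.isTest, (coeFn_sobolevEmbedding w).trans hw.fst_ae_eq, hw.snd_ae_eq⟩
    have hfst : ‖w.1.fst‖ ^ 2 = ∫ x, φ x ^ 2 := by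
      rw [norm_sq_Lp_two]
      refine integral_congr_ae ?_
      filter_upwards [hw.fst_ae_eq] with x hx
      rw [hx, Real.norm_eq_abs, sq_abs]
    rw [hT, hfst, hW.schrodingerBilin_self, hw.integral_eq_schrodingerForm]
    exact hC φ hw.isTest.to_univ

lemma hasLpBound_multiPotential (ha : Function.Injective a)
    (hV : ∀ i b, IsPolePotential b fun x => angularPotential (h i) (x - b))
    (hpos : ∀ i φ, IsTest univ φ → 0 ≤ schrodingerForm (angularPotential (h i)) φ) :
    HasLpBound (ENNReal.ofReal (twoStar N)) (minS h) (multiPotential a h) := by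
  have hV₀ (i : Fin k) : IsFormBounded univ (angularPotential (h i)) := by
    simpa using (hV i 0).isFormBounded
  refine hasLpBound_sum ?_ (minS_nonneg fun i => singleS_nonneg (hV₀ i) (hpos i)) ha.injOn
    (fun i _ => hV i (a i)) (hasLpBound_zero_of_le_sobolevS (minS_le_sobolevS h))
    fun i _ => hasLpBound_angularPotential (hV₀ i) (hpos i) (minS_le_singleS h i) (a i)
  rw [← ENNReal.ofReal_ofNat, ENNReal.ofReal_le_ofReal_iff] <;> linarith [two_lt_twoStar N]

end DirichletSpace

end MultiHardy

theorem mainTheorem8_general {N k : ℕ} [Fact (3 ≤ N)] {Ω : Set (Euc N)} (hΩ : IsOpen Ω)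
    (hΩb : Bornology.IsBounded Ω) {a : Fin k → Euc N} (ha : Function.Injective a)
    (haΩ : ∀ i, a i ∈ Ω) {h : Fin k → Sph N → ℝ} (hh : ∀ i, Measurable (h i))
    (hhb : ∀ i, ∃ C, ∀ s, |h i s| ≤ C) (hQ : FormPosDef Ω a h) {Λ : ℝ} (hΛ : Λ ≤ domainS Ω a h)
    {u : ℕ → H10 N Ω} {c : ℝ}
    (hJ : Tendsto (fun n => energyJ Ω a h Λ (u n)) atTop (𝓝 c))
    (hJ' : Tendsto (fun n => fderiv ℝ (energyJ Ω a h Λ) (u n)) atTop (𝓝 0))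
    (hc : c < 1 / N * domainS Ω a h ^ (1 - (N : ℝ) / 2) * minS h ^ ((N : ℝ) / 2)) :
    ∃ σ : ℕ → ℕ, StrictMono σ ∧ ∃ v : H10 N Ω, Tendsto (fun n => u (σ n)) atTop (𝓝 v) := by
  have hN : 3 ≤ N := Fact.out
  have hN' : (3 : ℝ) ≤ N := mod_cast hN
  have hV (i : Fin k) (b : Euc N) : IsPolePotential b fun x => angularPotential (h i) (x - b) :=
    isPolePotential_angularPotential hN (hh i) (hhb i) b
  have hpos (i : Fin k) (φ : Euc N → ℝ) (hφ : IsTest univ φ) :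
      0 ≤ schrodingerForm (angularPotential (h i)) φ :=
    hQ.schrodingerForm_angularPotential_nonneg (fun i => hV i (a i)) ha
      (hΩ.mem_nhds (haΩ i)) hφ
  obtain ⟨κ, hκ, hcoercive⟩ := hQ.exists_mul_sq_norm_le hN hΩb
  simp only [← schrodingerBilin_multiPotential_self fun i => hV i (a i)] at hcoercive
  obtain ⟨C, hC⟩ := (hasLpBound_multiPotential ha hV hpos).exists_le_schrodingerBilin
    (isFormBounded_multiPotential fun i => hV i (a i))
  have hm : 0 ≤ minS h :=
    minS_nonneg fun i => singleS_nonneg (by simpa using (hV i 0).isFormBounded) (hpos i)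
  refine (IsPalaisSmale.of_energyJ (fun i => hV i (a i)) hJ hJ').exists_subseq_tendsto
    (R := fstCLM N 2 Ω) (by linarith) (inv_twoStar N) hm hκ hcoercive coeFn_sobolevEmbedding hC
    (fun z M hz hweak => tendsto_fst_of_forall_tendsto_apply hΩb hz hweak)
    fun hΛ₀ => hc.trans_le ?_
  have hrpow : domainS Ω a h ^ (1 - (N : ℝ) / 2) ≤ Λ ^ (1 - (N : ℝ) / 2) :=
    Real.rpow_le_rpow_of_nonpos hΛ₀ hΛ (by linarith)
  gcongr

theorem mainTheorem8 {N k : ℕ} [Fact (3 ≤ N)] (Ω : Set (Euc N)) (hΩ : IsBoundedSmoothDomain Ω)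
    (a : Fin k → Euc N) (ha : Function.Injective a) (haΩ : ∀ i, a i ∈ Ω)
    (h : Fin k → Sph N → ℝ) (hh : ∀ i, ContMDiff (𝓡 (N - 1)) 𝓘(ℝ, ℝ) 1 (h i))
    (hQ : FormPosDef Ω a h)
    (Λ : ℝ)
    (hΛ : Λ = domainS Ω a h ∨
      (BddBelow (Set.range fun w : {w : D12 N // w ≠ 0} => wholeQuotient a h w.1) ∧
        Λ = wholeS a h))
    (u : ℕ → H10 N Ω) (c : ℝ)
    (hJ : Tendsto (fun n => energyJ Ω a h Λ (u n)) atTop (𝓝 c))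
    (hJ' : Tendsto (fun n => fderiv ℝ (energyJ Ω a h Λ) (u n)) atTop (𝓝 0))
    (hc : c < 1 / N * domainS Ω a h ^ (1 - (N : ℝ) / 2) * minS h ^ ((N : ℝ) / 2)) :
    ∃ σ : ℕ → ℕ, StrictMono σ ∧ ∃ v : H10 N Ω, Tendsto (fun n => u (σ n)) atTop (𝓝 v) := by
  refine mainTheorem8_general hΩ.isOpen hΩ.isBounded ha haΩ
    (fun i => (hh i).continuous.measurable) (fun i => ?_) hQ ?_ hJ hJ' hc
  · simpa using isCompact_univ.exists_bound_of_continuousOn (hh i).continuous.continuousOn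
  · rcases hΛ with rfl | ⟨hb, rfl⟩
    exacts [le_rfl, wholeS_le_domainS hΩ.isOpen hΩ.isConnected.nonempty hb]
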